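/- Let $V$ be a finite-dimensional real inner product space and let $\Omega\subseteq V$ be a symmetric cone, i.e. an open convex cone ($\lambda\Omega\subseteq\Omega$ for $\lambda>0$) that equals its open dual cone $\Omega^*=\{y\in V : \langle x,y\rangle>0 \text{ for all nonzero } x\in\overline\Omega\}$ and on which the group $\mathcal G(\Omega)=\{g\in \mathrm{GL}(V): g\Omega=\Omega\}$ acts transitively. Let $\mathcal G_0(\Omega)$ be the identity component of $\mathcal G(\Omega)$, let $\mathcal K=\mathcal G_0(\Omega)\cap \mathrm O(V)$, and let $\mathcal H=\mathcal A\mathcal N$ be the solvable subgroup of an Iwasawa decomposition $\mathcal G_0(\Omega)=\mathcal K\mathcal A\mathcal N$. That is, with $\mathfrak g$ the Lie algebra of $\mathcal G(\Omega)$, $\mathfrak a$ is a maximal abelian subspace of the space of self-adjoint elements of $\mathfrak g$, $\mathfrak n$ is the sum of the root spaces of $\mathfrak a$ in $\mathfrak g$ for the roots in a Weyl-chamber system of positive roots, and $\mathcal A$, $\mathcal N$ are the connected subgroups with Lie algebras $\mathfrak a$, $\mathfrak n$. Let $\mu_{\mathcal H}$, also written $dh$, be a left Haar measure on $\mathcal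 H$, and write $h^*$ for the adjoint of $h$ with respect to the inner product of $V$. Then there is a constant $C>0$ such that for every right-$\mathcal K$-invariant function $F:\mathcal G_0(\Omega)\to\mathbb C$ whose restriction to $\mathcal H$ is $\mu_{\mathcal H}$-integrable, the function $h\mapsto F((h^*)^{-1})$ on $\mathcal H$ is also $\mu_{\mathcal H}$-integrable and $$\int_{\mathcal H} F(h)\,dh = C\int_{\mathcal H} F((h^*)^{-1})\,dh .$$ -/

import Mathlib

open MeasureTheory

/-- The group `GL(V)` of invertible linear maps of a finite-dimensional real inner product space,
as a topological group. For `g : GLV V`, `star g` is the adjoint of `g`. -/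
abbrev GLV (V : Type*) [NormedAddCommGroup V] [InnerProductSpace ℝ V] : Type _ :=
  (V →L[ℝ] V)ˣ

section Cone

variable {V : Type*} [NormedAddCommGroup V] [InnerProductSpace ℝ V]

/-- The open dual cone `{y | ⟪x, y⟫ > 0 for all non-zero x in the closure of Ω}`. -/
def openDualCone (Ω : Set V) : Set V :=
  {y | ∀ x ∈ closure Ω, x ≠ 0 → 0 < inner ℝ x y}

/-- The automorphism group `{g ∈ GL(V) | g Ω = Ω}`. -/
def coneAut (Ω : Set V) : Subgroup (GLV V) where
  carrier := {g | (fun x => (g : V →L[ℝ] V) x) '' Ω = Ω}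
  one_mem' := by simp
  mul_mem' := by
    intro a b ha hb
    have h : (fun x => ((a * b : GLV V) : V →L[ℝ] V) x) '' Ω =
        (fun x => (a : V →L[ℝ] V) x) '' ((fun x => (b : V →L[ℝ] V) x) '' Ω) := by
      rw [Set.image_image]; rfl
    simp only [Set.mem_ofPred_eq] at ha hb ⊢
    rw [h, hb, ha]
  inv_mem' := by
    intro a ha
    simp only [Set.mem_ofPred_eq] at ha ⊢
    conv_lhs => rw [← ha]
    rw [Set.image_image]
    have h : ∀ x, ((a⁻¹ : GLV V) : V →L[ℝ] V) ((a : V →L[ℝ] V) x) = x := fun x => by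
      rw [← mul_apply_eq_comp, Units.inv_mul, one_apply_eq_self]
    simp [h]

/-- A symmetric cone: an open convex cone which is equal to its open dual cone and whose
automorphism group acts transitively on it. -/
structure IsSymmetricCone (Ω : Set V) : Prop where
  isOpen : IsOpen Ω
  convex : Convex ℝ Ω
  smul_mem : ∀ c : ℝ, 0 < c → ∀ x ∈ Ω, c • x ∈ Ω
  self_dual : openDualCone Ω = Ω
  transitive : ∀ x ∈ Ω, ∀ y ∈ Ω, ∃ g ∈ coneAut Ω, (g : V →L[ℝ] V) x = y

/-- The connected component `𝒢₀(Ω)` of the identity in the automorphism group of `Ω`. -/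
noncomputable def coneAutZero (Ω : Set V) : Subgroup (GLV V) :=
  (Subgroup.connectedComponentOfOne (coneAut Ω)).map (coneAut Ω).subtype

/-- The orthogonal group `O(V)`. -/
def orthGroup (V : Type*) [NormedAddCommGroup V] [InnerProductSpace ℝ V] : Subgroup (GLV V) where
  carrier := {k | ∀ x, ‖(k : V →L[ℝ] V) x‖ = ‖x‖}
  one_mem' := by simp
  mul_mem' := by
    intro a b ha hb x
    rw [Units.val_mul, mul_apply_eq_comp, ha, hb]
  inv_mem' := by
    intro a ha x
    rw [← ha, ← mul_apply_eq_comp, Units.mul_inv, one_apply_eq_self]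

/-- The group `𝒦 = 𝒢₀(Ω) ∩ O(V)`. -/
noncomputable def coneK (Ω : Set V) : Subgroup (GLV V) := coneAutZero Ω ⊓ orthGroup V

/-- The Lie algebra `𝔤` of `𝒢(Ω)`: all `X` such that `exp (t X) ∈ 𝒢(Ω)` for all real `t`. -/
def coneLie (Ω : Set V) : Set (V →L[ℝ] V) :=
  {X | ∀ t : ℝ, ∃ g ∈ coneAut Ω, (g : V →L[ℝ] V) = NormedSpace.exp (t • X)}

/-- `𝔞` is a maximal abelian subspace of `𝔭`, the set of self-adjoint elements of `𝔤`. -/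
def IsMaximalAbelianInP [CompleteSpace V] (Ω : Set V) (𝔞 : Submodule ℝ (V →L[ℝ] V)) : Prop :=
  Maximal (fun 𝔟 : Submodule ℝ (V →L[ℝ] V) =>
    (∀ X ∈ 𝔟, X ∈ coneLie Ω ∧ IsSelfAdjoint X) ∧ ∀ X ∈ 𝔟, ∀ Y ∈ 𝔟, ⁅X, Y⁆ = 0) 𝔞

/-- The joint eigenspace `𝔤_α = {X ∈ 𝔤 | [Y, X] = α(Y) X for all Y ∈ 𝔞}` of `ad 𝔞` on `𝔤`. -/
def rootVectors (Ω : Set V) (𝔞 : Submodule ℝ (V →L[ℝ] V)) (α : Module.Dual ℝ 𝔞) :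
    Set (V →L[ℝ] V) :=
  {X | X ∈ coneLie Ω ∧ ∀ Y : 𝔞, ⁅(Y : V →L[ℝ] V), X⁆ = α Y • X}

/-- `α` is a restricted root: `α ≠ 0` and `𝔤_α ≠ 0`. -/
def IsRestrictedRoot (Ω : Set V) (𝔞 : Submodule ℝ (V →L[ℝ] V)) (α : Module.Dual ℝ 𝔞) : Prop :=
  α ≠ 0 ∧ ∃ X ∈ rootVectors Ω 𝔞 α, X ≠ 0

/-- `Z ∈ 𝔞` is regular: no restricted root vanishes at `Z`. Such a `Z` determines a Weyl chamber,
equivalently the system of positive roots `{α | 0 < α Z}`; all systems of positive roots arise in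
this way. -/
def IsRegularElement (Ω : Set V) (𝔞 : Submodule ℝ (V →L[ℝ] V)) (Z : 𝔞) : Prop :=
  ∀ α : Module.Dual ℝ 𝔞, IsRestrictedRoot Ω 𝔞 α → α Z ≠ 0

/-- The sum `𝔫` of the root spaces `𝔤_α` over the roots `α` which are positive at `Z`. -/
def nilLie (Ω : Set V) (𝔞 : Submodule ℝ (V →L[ℝ] V)) (Z : 𝔞) : Submodule ℝ (V →L[ℝ] V) :=
  Submodule.span ℝ {X | ∃ α : Module.Dual ℝ 𝔞,
    IsRestrictedRoot Ω 𝔞 α ∧ 0 < α Z ∧ X ∈ rootVectors Ω 𝔞 α}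

/-- The subgroup of `GL(V)` generated by `exp X`, `X ∈ 𝔟`. -/
def expSubgroup (𝔟 : Submodule ℝ (V →L[ℝ] V)) : Subgroup (GLV V) :=
  Subgroup.closure {g | ∃ X ∈ 𝔟, (g : V →L[ℝ] V) = NormedSpace.exp X}

/-- The solvable subgroup `ℋ = 𝒜𝒩` of an Iwasawa decomposition `𝒢₀(Ω) = 𝒦𝒜𝒩`, where `𝒜` and `𝒩`
are the connected subgroups with Lie algebras `𝔞` and `𝔫`. As `𝒜` normalizes `𝒩`, the product
`𝒜𝒩` is the subgroup generated by `𝒜` and `𝒩`. -/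
def iwasawaAN (Ω : Set V) (𝔞 : Submodule ℝ (V →L[ℝ] V)) (Z : 𝔞) : Subgroup (GLV V) :=
  expSubgroup 𝔞 ⊔ expSubgroup (nilLie Ω 𝔞 Z)

end Cone

/-! ### Exponentials and tangent vectors to closed monoids in a Banach algebra -/

section BanachAlgebra

open Filter Topology NormedSpace

variable {𝔸 : Type*} [NormedRing 𝔸] [NormedAlgebra ℝ 𝔸] [CompleteSpace 𝔸]

/-! Write φ(y) = ∫_Ω exp(-⟪x, y⟫) dx. Two facts are needed. There is a base point e ∈ Ω whose
stabiliser in 𝒢(Ω) is exactly 𝒢(Ω) ∩ O(V) (`exists_mem_stabilizer_le_orthGroup`), and ℋ acts simply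
transitively on Ω, so that h ↦ h e is a homeomorphism of ℋ onto Ω (`isOpenEmbedding_orbitMap`,
`range_orbitMap`).

Since φ(y) = |det g| φ(g y), the measure φ(y) dy is invariant under 𝒢(Ω). Pulled back to ℋ it is a
left Haar measure, so μ is invariant under the whole of 𝒢(Ω), transported from Ω to ℋ
(`map_eq_self_of_orbitMap_eq`). Define σ on ℋ by σ(h) e = (h*)⁻¹ e. Then σ(h) and (h*)⁻¹ differ by
an element of 𝒦 on the right, hence F((h*)⁻¹) = F(σ(h)). Moreover h₀ σ(h) = σ(a(h)), where a is the
transport of (h₀*)⁻¹ and preserves μ. So the image of μ under σ is left invariant, equals c μ by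
uniqueness of Haar measure, and C = 1/c works.

The base point is the minimiser of φ + ‖·‖²/2: strict convexity of φ makes its stabiliser stable
under adjoints, and boundedness of powers then makes the stabiliser orthogonal.

For simple transitivity, the evaluation 𝔞 × 𝔫 → V is bijective at each point of Ω: the root
decomposition gives surjectivity at e, and a trace computation gives injectivity everywhere. Orbits
are therefore open, and Ω is connected. Freeness is a trace inequality
(`eq_one_of_mem_iwasawaAN_of_apply_eq`). The remaining input, 𝔤 e = V, is extracted from
transitivity by compactness (`exists_mem_lie_apply_eq`). Neither the Iwasawa decomposition nor
closedness of ℋ is presupposed. -/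

theorem continuous_exp_real : Continuous (exp : 𝔸 → 𝔸) :=
  letI := NormedAlgebra.restrictScalars ℚ ℝ 𝔸
  exp_continuous

theorem exp_add_of_commute_real {x y : 𝔸} (h : Commute x y) : exp (x + y) = exp x * exp y :=
  letI := NormedAlgebra.restrictScalars ℚ ℝ 𝔸
  exp_add_of_commute h

theorem exp_mul_exp_neg_real (x : 𝔸) : exp x * exp (-x) = 1 := by
  rw [← exp_add_of_commute_real (Commute.refl x).neg_right, add_neg_cancel, exp_zero]

theorem exp_neg_mul_exp_real (x : 𝔸) : exp (-x) * exp x = 1 := by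
  rw [← exp_add_of_commute_real (Commute.refl x).neg_left, neg_add_cancel, exp_zero]

theorem exp_pow_real (x : 𝔸) (n : ℕ) : exp x ^ n = exp ((n : ℝ) • x) := by
  let _ := NormedAlgebra.restrictScalars ℚ ℝ 𝔸
  rw [← exp_nsmul, Nat.cast_smul_eq_nsmul]

theorem exp_units_conj_real (y : 𝔸ˣ) (x : 𝔸) : exp (y * x * ↑y⁻¹ : 𝔸) = y * exp x * ↑y⁻¹ :=
  letI := NormedAlgebra.restrictScalars ℚ ℝ 𝔸
  exp_units_conj y x

/-- The exponential as an invertible element. -/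
noncomputable def expUnit (x : 𝔸) : 𝔸ˣ :=
  ⟨exp x, exp (-x), exp_mul_exp_neg_real x, exp_neg_mul_exp_real x⟩

@[simp]
theorem val_expUnit (x : 𝔸) : (expUnit x : 𝔸) = exp x := rfl

@[simp]
theorem val_inv_expUnit (x : 𝔸) : ((expUnit x)⁻¹ : 𝔸ˣ).val = exp (-x) := rfl

theorem inv_expUnit (x : 𝔸) : (expUnit x)⁻¹ = expUnit (-x) := Units.ext rfl

@[simp]
theorem expUnit_zero : expUnit (0 : 𝔸) = 1 := Units.ext (by simp)

theorem continuous_expUnit : Continuous (expUnit : 𝔸 → 𝔸ˣ) :=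
  Units.continuous_iff.2 ⟨continuous_exp_real, continuous_exp_real.comp continuous_neg⟩

theorem hasDerivAt_exp_smul_zero (x : 𝔸) : HasDerivAt (fun t : ℝ => exp (t • x)) x 0 := by
  simpa using hasDerivAt_exp_smul_const (𝕂 := ℝ) x 0

omit [NormedAlgebra ℝ 𝔸] [CompleteSpace 𝔸] in
-- Telescoping. The bound on `‖1‖` stands in for a norm-one assumption, which fails for the
-- endomorphisms of the zero space.
theorem norm_pow_sub_pow_le (h1 : ‖(1 : 𝔸)‖ ≤ 1) {a b : 𝔸} {K : ℝ} (hK : 1 ≤ K)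
    (ha : ‖a‖ ≤ K) (hb : ‖b‖ ≤ K) (n : ℕ) : ‖a ^ n - b ^ n‖ ≤ n * K ^ n * ‖a - b‖ := by
  have hbn : ∀ m : ℕ, ‖b ^ m‖ ≤ K ^ m := by
    intro m
    induction m with
    | zero => simpa using h1
    | succ m ih =>
      rw [pow_succ, pow_succ]
      exact (norm_mul_le _ _).trans (by gcongr)
  induction n with
  | zero => simp
  | succ n ih =>
    have e : a ^ (n + 1) - b ^ (n + 1) = a * (a ^ n - b ^ n) + (a - b) * b ^ n := by
      rw [pow_succ', pow_succ', mul_sub, sub_mul]; abel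
    rw [e]
    calc _ ≤ ‖a‖ * ‖a ^ n - b ^ n‖ + ‖a - b‖ * ‖b ^ n‖ :=
          (norm_add_le _ _).trans (add_le_add (norm_mul_le _ _) (norm_mul_le _ _))
      _ ≤ K * (n * K ^ n * ‖a - b‖) + ‖a - b‖ * K ^ n := by
          gcongr; exact hbn n
      _ ≤ K * (n * K ^ n * ‖a - b‖) + ‖a - b‖ * K ^ (n + 1) := by
          gcongr; exact Nat.le_succ n
      _ = _ := by push_cast; ring

/-- A tangent vector at `1` to a closed submonoid generates a one-parameter semigroup in it. -/
theorem exp_smul_mem_of_tendsto (h1 : ‖(1 : 𝔸)‖ ≤ 1) {M : Submonoid 𝔸}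
    (hM : IsClosed (M : Set 𝔸)) {ι : Type*} {l : Filter ι} [NeBot l] {g : ι → 𝔸} {t : ι → ℝ}
    {X : 𝔸} (hg : ∀ᶠ i in l, g i ∈ M) (ht : ∀ᶠ i in l, 0 < t i) (ht0 : Tendsto t l (𝓝 0))
    (hX : Tendsto (fun i => (t i)⁻¹ • (g i - 1)) l (𝓝 X)) {s : ℝ} (hs : 0 ≤ s) :
    exp (s • X) ∈ M := by
  set b : ι → 𝔸 := fun i => exp (t i • X) with hb
  -- With this many factors of step `t i`, the time `s` is reached up to an error below `t i`.
  set k : ι → ℕ := fun i => ⌊s / t i⌋₊ with hk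
  have hbX : Tendsto (fun i => (t i)⁻¹ • (b i - 1)) l (𝓝 X) := by
    have h := (hasDerivAt_exp_smul_zero X).tendsto_slope_zero
    have h2 : Tendsto t l (𝓝[≠] 0) :=
      tendsto_nhdsWithin_iff.2 ⟨ht0, ht.mono fun i hi => ne_of_gt hi⟩
    simpa [hb] using! h.comp h2
  have hdiff : Tendsto (fun i => (t i)⁻¹ • (g i - b i)) l (𝓝 0) := by
    have := hX.sub hbX
    simpa [← smul_sub] using this
  set C : ℝ := ‖X‖ + 1
  have key : ∀ a : ι → 𝔸, Tendsto (fun i => (t i)⁻¹ • (a i - 1)) l (𝓝 X) →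
      ∀ᶠ i in l, ‖a i‖ ≤ Real.exp (C * t i) := by
    intro a ha
    have h2 : ∀ᶠ i in l, ‖(t i)⁻¹ • (a i - 1)‖ < C :=
      ha.norm.eventually_lt_const (by simp [C])
    filter_upwards [h2, ht] with i hi hti
    rw [norm_smul, norm_inv, Real.norm_of_nonneg hti.le, inv_mul_lt_iff₀ hti] at hi
    calc ‖a i‖ = ‖(a i - 1) + 1‖ := by simp
      _ ≤ ‖a i - 1‖ + 1 := (norm_add_le _ _).trans (by gcongr)
      _ ≤ C * t i + 1 := by linarith
      _ ≤ _ := Real.add_one_le_exp _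
  have hkt : ∀ᶠ i in l, k i * t i ≤ s := by
    filter_upwards [ht] with i hi
    have := Nat.floor_le (div_nonneg hs hi.le)
    rwa [le_div_iff₀ hi] at this
  have hklim : Tendsto (fun i => (k i : ℝ) * t i) l (𝓝 s) := by
    refine tendsto_of_tendsto_of_tendsto_of_le_of_le' (g := fun i => s - t i)
      (by simpa using tendsto_const_nhds.sub ht0) tendsto_const_nhds ?_ hkt
    filter_upwards [ht] with i hi
    have := (Nat.lt_floor_add_one (s / t i)).le
    rw [div_le_iff₀ hi] at this
    simp only [hk]; linarith
  have hbk : Tendsto (fun i => b i ^ k i) l (𝓝 (exp (s • X))) := by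
    have := ((continuous_exp_real (𝔸 := 𝔸)).tendsto (s • X)).comp (hklim.smul_const X)
    refine this.congr fun i => ?_
    simp [hb, exp_pow_real, smul_smul]
  -- Both `g i` and `exp (t i • X)` have norm at most `exp (C * t i)` and differ by `o(t i)`, so
  -- their `k i`-th powers differ by `k i * o(t i)`, which tends to `0`.
  have hzero : Tendsto (fun i => g i ^ k i - b i ^ k i) l (𝓝 0) := by
    refine squeeze_zero_norm' (a := fun i => s * Real.exp (C * s) * ‖(t i)⁻¹ • (g i - b i)‖) ?_ ?_
    · filter_upwards [key g hX, key b hbX, ht, hkt] with i h2 h3 h4 h5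
      have hC : 0 ≤ C := by positivity
      refine (norm_pow_sub_pow_le h1 (Real.one_le_exp (by positivity)) h2 h3 _).trans ?_
      rw [norm_smul, norm_inv, Real.norm_of_nonneg h4.le, ← Real.exp_nat_mul]
      calc _ = (k i * t i) * Real.exp (C * (k i * t i)) * ((t i)⁻¹ * ‖g i - b i‖) := by
            field_simp
        _ ≤ _ := by gcongr
    · simpa using hdiff.norm.const_mul (s * Real.exp (C * s))
  have hlim : Tendsto (fun i => g i ^ k i) l (𝓝 (exp (s • X))) := by
    simpa using hzero.add hbk
  exact hM.mem_of_tendsto hlim (hg.mono fun i hi => pow_mem hi _)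

end BanachAlgebra

/-! ### Geometry of a self-dual cone and of the maps preserving it -/

section SymmetricCone

open Filter Topology

variable {V : Type*} [NormedAddCommGroup V] [InnerProductSpace ℝ V] {Ω : Set V}

theorem map_mem_of_mem_coneAut {g : GLV V} (hg : g ∈ coneAut Ω) {x : V} (hx : x ∈ Ω) :
    (g : V →L[ℝ] V) x ∈ Ω := by
  have h : (fun x => (g : V →L[ℝ] V) x) '' Ω = Ω := hg
  rw [← h]
  exact ⟨x, hx, rfl⟩

@[simp]
theorem units_inv_apply_apply (g : GLV V) (x : V) :
    ((g⁻¹ : GLV V) : V →L[ℝ] V) ((g : V →L[ℝ] V) x) = x := by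
  rw [← mul_apply_eq_comp, Units.inv_mul, one_apply_eq_self]

@[simp]
theorem units_apply_inv_apply (g : GLV V) (x : V) :
    (g : V →L[ℝ] V) (((g⁻¹ : GLV V) : V →L[ℝ] V) x) = x := by
  rw [← mul_apply_eq_comp, Units.mul_inv, one_apply_eq_self]

theorem units_mul_apply (g h : GLV V) (x : V) :
    ((g * h : GLV V) : V →L[ℝ] V) x = (g : V →L[ℝ] V) ((h : V →L[ℝ] V) x) := rfl

theorem mem_coneAut_of_mapsTo {g : GLV V} (h₁ : ∀ x ∈ Ω, (g : V →L[ℝ] V) x ∈ Ω)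
    (h₂ : ∀ x ∈ Ω, ((g⁻¹ : GLV V) : V →L[ℝ] V) x ∈ Ω) : g ∈ coneAut Ω := by
  change (fun x => (g : V →L[ℝ] V) x) '' Ω = Ω
  refine Set.Subset.antisymm (by rintro _ ⟨x, hx, rfl⟩; exact h₁ x hx) fun x hx => ?_
  exact ⟨_, h₂ x hx, by simp⟩

/-- The monoid of endomorphisms of `V` which map the closure of `Ω` into itself. -/
def closureEnd (Ω : Set V) : Submonoid (V →L[ℝ] V) where
  carrier := {T | ∀ x ∈ closure Ω, T x ∈ closure Ω}
  one_mem' := by simp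
  mul_mem' := fun ha hb x hx => ha _ (hb x hx)

theorem mem_closureEnd {T : V →L[ℝ] V} :
    T ∈ closureEnd Ω ↔ ∀ x ∈ closure Ω, T x ∈ closure Ω := Iff.rfl

theorem isClosed_closureEnd : IsClosed (closureEnd Ω : Set (V →L[ℝ] V)) := by
  have : (closureEnd Ω : Set (V →L[ℝ] V)) =
      ⋂ x ∈ closure Ω, (fun T : V →L[ℝ] V => T x) ⁻¹' closure Ω := by
    ext T; simp [mem_closureEnd]
  rw [this]
  exact isClosed_biInter fun x _ => isClosed_closure.preimage (by fun_prop)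

theorem coe_mem_closureEnd {g : GLV V} (hg : g ∈ coneAut Ω) :
    (g : V →L[ℝ] V) ∈ closureEnd Ω := fun _ hx =>
  (show Set.MapsTo (g : V →L[ℝ] V) Ω Ω from fun _ h => map_mem_of_mem_coneAut hg h).closure
    (g : V →L[ℝ] V).continuous hx

namespace IsSymmetricCone

variable (hΩ : IsSymmetricCone Ω)
include hΩ

theorem mem_iff {y : V} : y ∈ Ω ↔ ∀ x ∈ closure Ω, x ≠ 0 → 0 < inner ℝ x y := by
  conv_lhs => rw [← hΩ.self_dual]
  rfl

theorem nonempty : Ω.Nonempty := by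
  rw [Set.nonempty_iff_ne_empty]
  intro h
  have : (0 : V) ∈ Ω := hΩ.mem_iff.2 (by simp [h])
  simp [h] at this

theorem inner_nonneg {x y : V} (hx : x ∈ closure Ω) (hy : y ∈ closure Ω) : 0 ≤ inner ℝ x y := by
  have hc : IsClosed {z : V | 0 ≤ inner ℝ x z} :=
    isClosed_le continuous_const (by fun_prop)
  refine hc.closure_subset_iff.2 (fun z hz => ?_) hy
  rcases eq_or_ne x 0 with rfl | h0
  · simp
  · exact (hΩ.mem_iff.1 hz x hx h0).le

/-- Self-duality makes ⟪x + w, x - w⟫ = ‖x‖² - ‖w‖² non-negative. -/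
theorem norm_le_of_add_mem_of_sub_mem {x w : V} (h₁ : x + w ∈ closure Ω)
    (h₂ : x - w ∈ closure Ω) : ‖w‖ ≤ ‖x‖ := by
  have h := hΩ.inner_nonneg h₁ h₂
  have h3 : inner ℝ (x + w) (x - w) = ‖x‖ ^ 2 - ‖w‖ ^ 2 := by
    rw [inner_add_left, inner_sub_right, inner_sub_right, real_inner_self_eq_norm_sq,
      real_inner_self_eq_norm_sq, real_inner_comm]
    ring
  rw [h3] at h
  exact le_of_sq_le_sq (by linarith) (norm_nonneg _)

/-- A cone-preserving map is controlled by its value at one interior point: e ± v ∈ Ω forces ‖T v‖ ≤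
‖T e‖ when ‖v‖ = δ. This is the source of all compactness below. -/
theorem opNorm_le {T : V →L[ℝ] V} (hT : T ∈ closureEnd Ω) {e : V} {δ : ℝ} (hδ : 0 < δ)
    (he : Metric.closedBall e δ ⊆ Ω) : ‖T‖ ≤ δ⁻¹ * ‖T e‖ := by
  refine T.opNorm_le_bound (by positivity) fun u => ?_
  rcases eq_or_ne u 0 with rfl | hu
  · simp
  have hu' : 0 < ‖u‖ := norm_pos_iff.2 hu
  set v : V := (δ * ‖u‖⁻¹) • u
  have hv : ‖v‖ = δ := by
    simp only [v, norm_smul, norm_mul, norm_inv, norm_norm, Real.norm_of_nonneg hδ.le]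
    field_simp
  have h1 : T (e + v) ∈ closure Ω := hT _ (subset_closure (he (by simp [hv])))
  have h2 : T (e - v) ∈ closure Ω := hT _ (subset_closure (he (by simp [hv])))
  rw [map_add] at h1
  rw [map_sub] at h2
  have h3 := hΩ.norm_le_of_add_mem_of_sub_mem h1 h2
  simp only [v, map_smul, norm_smul, norm_mul, norm_inv, norm_norm,
    Real.norm_of_nonneg hδ.le] at h3
  calc ‖T u‖ = δ⁻¹ * (δ * ‖u‖⁻¹ * ‖T u‖) * ‖u‖ := by field_simp
    _ ≤ δ⁻¹ * ‖T e‖ * ‖u‖ := by gcongr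

theorem exists_closedBall_subset {e : V} (he : e ∈ Ω) :
    ∃ δ > 0, Metric.closedBall e δ ⊆ Ω :=
  Metric.nhds_basis_closedBall.mem_iff.1 (hΩ.isOpen.mem_nhds he)

theorem interior_closure : interior (closure Ω) = Ω := by
  rw [hΩ.convex.interior_closure_eq_interior_of_nonempty_interior, hΩ.isOpen.interior_eq]
  rw [hΩ.isOpen.interior_eq]; exact hΩ.nonempty

/-- An open convex cone is the interior of its closure, so membership becomes a pair of closed
conditions, stable under limits of `g` and `g⁻¹`. -/
theorem mem_coneAut_iff {g : GLV V} : g ∈ coneAut Ω ↔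
    (g : V →L[ℝ] V) ∈ closureEnd Ω ∧ ((g⁻¹ : GLV V) : V →L[ℝ] V) ∈ closureEnd Ω := by
  refine ⟨fun h => ⟨coe_mem_closureEnd h, coe_mem_closureEnd (inv_mem h)⟩, ?_⟩
  have key : ∀ g : GLV V, (g : V →L[ℝ] V) ∈ closureEnd Ω →
      ∀ x ∈ Ω, (g : V →L[ℝ] V) x ∈ Ω := by
    intro g hg x hx
    have hopen : IsOpen ((g : V →L[ℝ] V) '' Ω) := by
      have : (g : V →L[ℝ] V) '' Ω = ((g⁻¹ : GLV V) : V →L[ℝ] V) ⁻¹' Ω := by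
        ext z
        constructor
        · rintro ⟨w, hw, rfl⟩; simpa using hw
        · intro hz; exact ⟨_, hz, by simp⟩
      rw [this]
      exact hΩ.isOpen.preimage (by fun_prop)
    have hsub : (g : V →L[ℝ] V) '' Ω ⊆ closure Ω := by
      rintro _ ⟨w, hw, rfl⟩; exact hg w (subset_closure hw)
    have := interior_maximal hsub hopen
    rw [hΩ.interior_closure] at this
    exact this ⟨x, hx, rfl⟩
  exact fun h => mem_coneAut_of_mapsTo (key g h.1) (key g⁻¹ h.2)

theorem smul_mem_closure {c : ℝ} (hc : 0 ≤ c) {x : V} (hx : x ∈ closure Ω) :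
    c • x ∈ closure Ω := by
  have key : ∀ c : ℝ, 0 < c → c • x ∈ closure Ω := fun c hc =>
    (show Set.MapsTo (fun x : V => c • x) Ω Ω from fun z hz => hΩ.smul_mem c hc z hz).closure
      (by fun_prop) hx
  rcases hc.eq_or_lt with rfl | h
  · have ht : Tendsto (fun r : ℝ => r • x) (𝓝[>] 0) (𝓝 ((0 : ℝ) • x)) :=
      (Continuous.tendsto (by fun_prop) 0).mono_left nhdsWithin_le_nhds
    exact isClosed_closure.mem_of_tendsto ht
      (eventually_mem_nhdsWithin.mono fun r hr => key r hr)
  · exact key c h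

theorem add_mem {x y : V} (hx : x ∈ Ω) (hy : y ∈ closure Ω) : x + y ∈ Ω := by
  refine hΩ.mem_iff.2 fun z hz h0 => ?_
  rw [inner_add_right]
  exact add_pos_of_pos_of_nonneg (hΩ.mem_iff.1 hx z hz h0) (hΩ.inner_nonneg hz hy)

/-- Pair `x` with the point y - δ x/‖x‖, which is still in the cone. -/
theorem mul_norm_le_inner {y : V} {δ : ℝ} (hδ : 0 ≤ δ) (hy : Metric.closedBall y δ ⊆ Ω) {x : V}
    (hx : x ∈ closure Ω) : δ * ‖x‖ ≤ inner ℝ x y := by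
  rcases eq_or_ne x 0 with rfl | h0
  · simp
  have h0' : 0 < ‖x‖ := norm_pos_iff.2 h0
  have h1 : y - (δ * ‖x‖⁻¹) • x ∈ Ω := by
    apply hy
    simp only [Metric.mem_closedBall, dist_self_sub_left, norm_smul, norm_mul, norm_inv, norm_norm,
      Real.norm_of_nonneg hδ]
    field_simp; rfl
  have h2 := hΩ.inner_nonneg hx (subset_closure h1)
  rw [inner_sub_right, inner_smul_right, real_inner_self_eq_norm_sq] at h2
  have : δ * ‖x‖⁻¹ * ‖x‖ ^ 2 = δ * ‖x‖ := by field_simp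
  linarith

variable [CompleteSpace V]

/-- Self-duality, through ⟪z, g* x⟫ = ⟪g z, x⟫. -/
theorem star_mem {g : GLV V} (hg : g ∈ coneAut Ω) : star g ∈ coneAut Ω := by
  have key : ∀ g ∈ coneAut Ω, ∀ x ∈ Ω, ((star g : GLV V) : V →L[ℝ] V) x ∈ Ω := by
    intro g hg x hx
    refine hΩ.mem_iff.2 fun z hz h0 => ?_
    have : inner ℝ z (((star g : GLV V) : V →L[ℝ] V) x) = inner ℝ ((g : V →L[ℝ] V) z) x := by
      rw [Units.coe_star, ContinuousLinearMap.star_eq_adjoint,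
        ContinuousLinearMap.adjoint_inner_right]
    rw [this]
    refine hΩ.mem_iff.1 hx _ (coe_mem_closureEnd hg z hz) fun h => h0 ?_
    rw [← units_inv_apply_apply g z, h, map_zero]
  refine mem_coneAut_of_mapsTo (key g hg) fun x hx => ?_
  have : (star g)⁻¹ = star g⁻¹ := (star_inv g).symm
  rw [this]
  exact key _ (inv_mem hg) x hx

end IsSymmetricCone

theorem mem_orthGroup_iff [CompleteSpace V] {k : GLV V} : k ∈ orthGroup V ↔ star k * k = 1 := by
  constructor
  · intro h
    ext1
    simp only [Units.val_mul, Units.coe_star, Units.val_one]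
    refine (ContinuousLinearMap.norm_map_iff_adjoint_comp_self _).1 h
  · intro h
    refine (ContinuousLinearMap.norm_map_iff_adjoint_comp_self _).2 ?_
    have := congrArg Units.val h
    simpa using! this

theorem inv_star_of_mem_orthGroup [CompleteSpace V] {k : GLV V} (hk : k ∈ orthGroup V) :
    (star k)⁻¹ = k :=
  inv_eq_of_mul_eq_one_right (mem_orthGroup_iff.1 hk)

theorem inv_star_mul [CompleteSpace V] (g h : GLV V) :
    (star (g * h))⁻¹ = (star g)⁻¹ * (star h)⁻¹ := by
  rw [star_mul, mul_inv_rev]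

theorem inv_star_inv_star [CompleteSpace V] (g : GLV V) : (star (star g)⁻¹)⁻¹ = g := by
  rw [star_inv, star_star, inv_inv]

theorem inner_inv_star_apply [CompleteSpace V] (g : GLV V) (x y : V) :
    inner ℝ x (((star g)⁻¹ : GLV V).val y) = inner ℝ ((g⁻¹ : GLV V).val x) y := by
  rw [← star_inv, Units.coe_star, ContinuousLinearMap.star_eq_adjoint,
    ContinuousLinearMap.adjoint_inner_right]

end SymmetricCone

/-! ### The characteristic function of the cone -/

section CharacteristicFunction

open Filter Topology

variable {V : Type*} [NormedAddCommGroup V] [InnerProductSpace ℝ V] [FiniteDimensional ℝ V]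

theorem det_star_eq [CompleteSpace V] (T : V →L[ℝ] V) :
    (star T).det = T.det := by
  let b := stdOrthonormalBasis ℝ V
  have h : (T.adjoint : V →ₗ[ℝ] V) = LinearMap.adjoint (T : V →ₗ[ℝ] V) :=
    LinearMap.eq_adjoint_iff _ _ |>.2 fun x y => T.adjoint_inner_left y x
  change LinearMap.det (T.adjoint : V →ₗ[ℝ] V) = LinearMap.det (T : V →ₗ[ℝ] V)
  rw [h, ← LinearMap.det_toMatrix b.toBasis, LinearMap.toMatrix_adjoint,
    Matrix.det_conjTranspose, LinearMap.det_toMatrix, star_trivial]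

omit [InnerProductSpace ℝ V] [FiniteDimensional ℝ V] in
theorem exists_exp_neg_mul_norm_le {δ : ℝ} (hδ : 0 < δ) (m : ℕ) :
    ∃ C : ℝ, ∀ x : V, Real.exp (-(δ * ‖x‖)) ≤ C * (1 + ‖x‖) ^ (-(m : ℝ)) := by
  refine ⟨Real.exp δ * m.factorial / δ ^ m, fun x => ?_⟩
  have hx : 0 < 1 + ‖x‖ := by positivity
  have h := Real.pow_div_factorial_le_exp (x := δ * (1 + ‖x‖)) (by positivity) m
  have e : Real.exp (-(δ * ‖x‖)) = Real.exp δ / Real.exp (δ * (1 + ‖x‖)) := by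
    rw [← Real.exp_sub]; ring_nf
  rw [e, Real.rpow_neg hx.le, Real.rpow_natCast, div_le_iff₀ (Real.exp_pos _)]
  calc Real.exp δ = Real.exp δ * m.factorial / δ ^ m * ((1 + ‖x‖) ^ m)⁻¹ *
        ((δ * (1 + ‖x‖)) ^ m / m.factorial) := by
          rw [mul_pow]; field_simp
    _ ≤ _ := by gcongr

variable [MeasurableSpace V] [BorelSpace V]

theorem integrable_exp_neg_mul_norm {δ : ℝ} (hδ : 0 < δ) :
    Integrable (fun x : V => Real.exp (-(δ * ‖x‖))) volume := by
  obtain ⟨C, hC⟩ := exists_exp_neg_mul_norm_le (V := V) hδ (Module.finrank ℝ V + 1)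
  refine ((integrable_one_add_norm (E := V) (μ := volume)
    (r := ((Module.finrank ℝ V + 1 : ℕ) : ℝ)) (by push_cast; linarith)).const_mul C).mono'
    (by fun_prop) (ae_of_all _ fun x => ?_)
  rw [Real.norm_of_nonneg (Real.exp_pos _).le]
  exact hC x

/-- The characteristic function `y ↦ ∫_Ω exp (-⟪x, y⟫) dx` of a cone. -/
noncomputable def coneChar (Ω : Set V) (y : V) : ENNReal :=
  ∫⁻ x in Ω, ENNReal.ofReal (Real.exp (-inner ℝ x y))

/-- Fatou's lemma. -/
theorem lowerSemicontinuous_coneChar (Ω : Set V) : LowerSemicontinuous (coneChar Ω) := by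
  refine lowerSemicontinuous_iff_le_liminf.2 fun y => ?_
  have h := lintegral_liminf_le (μ := (volume : Measure V).restrict Ω)
    (f := fun y x => ENNReal.ofReal (Real.exp (-inner ℝ x y))) (u := 𝓝 y)
    (fun y => by fun_prop)
  refine le_trans (lintegral_mono fun x => ?_) h
  have : Continuous fun y : V => ENNReal.ofReal (Real.exp (-inner ℝ x y)) :=
    ENNReal.continuous_ofReal.comp (by fun_prop)
  exact (this.tendsto y).liminf_eq.ge

theorem measurable_coneChar (Ω : Set V) : Measurable (coneChar Ω) :=
  (lowerSemicontinuous_coneChar Ω).measurable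

namespace IsSymmetricCone

variable {Ω : Set V} (hΩ : IsSymmetricCone Ω)
include hΩ

theorem coneChar_le {y : V} {δ : ℝ} (hδ : 0 ≤ δ) (hy : Metric.closedBall y δ ⊆ Ω) :
    coneChar Ω y ≤ ∫⁻ x : V, ENNReal.ofReal (Real.exp (-(δ * ‖x‖))) := by
  refine (setLIntegral_mono (by fun_prop) fun x hx => ?_).trans (setLIntegral_le_lintegral Ω _)
  gcongr
  exact hΩ.mul_norm_le_inner hδ hy (subset_closure hx)

theorem integrableOn_exp {y : V} (hy : y ∈ Ω) :
    IntegrableOn (fun x => Real.exp (-inner ℝ x y)) Ω := by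
  obtain ⟨δ, hδ, hb⟩ := hΩ.exists_closedBall_subset hy
  refine (integrable_exp_neg_mul_norm hδ).integrableOn.mono' (by fun_prop)
    ((ae_restrict_iff' hΩ.isOpen.measurableSet).2 (ae_of_all _ fun x hx => ?_))
  rw [Real.norm_of_nonneg (Real.exp_pos _).le]
  gcongr
  exact hΩ.mul_norm_le_inner hδ.le hb (subset_closure hx)

theorem coneChar_eq_ofReal {y : V} (hy : y ∈ Ω) :
    coneChar Ω y = ENNReal.ofReal (∫ x in Ω, Real.exp (-inner ℝ x y)) := by
  rw [ofReal_integral_eq_lintegral_ofReal (hΩ.integrableOn_exp hy)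
    (ae_of_all _ fun x => (Real.exp_pos _).le)]
  rfl

theorem coneChar_ne_top {y : V} (hy : y ∈ Ω) : coneChar Ω y ≠ ⊤ := by
  rw [hΩ.coneChar_eq_ofReal hy]; exact ENNReal.ofReal_ne_top

theorem coneChar_pos (y : V) : coneChar Ω y ≠ 0 := by
  intro h
  rw [coneChar, lintegral_eq_zero_iff (by fun_prop)] at h
  have h2 : ∀ᵐ x ∂(volume : Measure V).restrict Ω, False := by
    filter_upwards [h] with x hx
    simp only [Pi.zero_apply, ENNReal.ofReal_eq_zero] at hx
    exact absurd (Real.exp_pos _) (not_lt.2 hx)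
  rw [eventually_false_iff_eq_bot, ae_eq_bot, Measure.restrict_eq_zero] at h2
  exact (hΩ.isOpen.measure_pos volume hΩ.nonempty).ne' h2

/-- Some nonzero x₀ in the closure has ⟪x₀, y⟫ ≤ 0. Along the ray w + n x₀ the integrand stays
bounded below on infinitely many disjoint balls of equal volume contained in Ω. -/
theorem coneChar_eq_top {y : V} (hy : y ∉ Ω) : coneChar Ω y = ⊤ := by
  rw [hΩ.mem_iff] at hy
  push Not at hy
  obtain ⟨x₀, hx₀, h0, hle⟩ := hy
  obtain ⟨w, hw⟩ := hΩ.nonempty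
  obtain ⟨δ, hδ, hb⟩ := hΩ.exists_closedBall_subset hw
  have hn : 0 < ‖x₀‖ := norm_pos_iff.2 h0
  -- Radius at most `δ` keeps the balls in Ω; consecutive centres are ‖x₀‖ apart, so `‖x₀‖ / 3`
  -- makes them disjoint.
  set r : ℝ := min δ (‖x₀‖ / 3)
  have hr : 0 < r := by positivity
  set s : ℕ → Set V := fun n => Metric.closedBall (w + (n : ℝ) • x₀) r
  have hsub : ∀ n, ∀ x ∈ s n, x - (n : ℝ) • x₀ ∈ Metric.closedBall w r := by
    intro n x hx
    simpa [s, dist_eq_norm, sub_sub, add_comm] using hx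
  have hsΩ : ∀ n, s n ⊆ Ω := by
    intro n x hx
    have h1 := hb (Metric.closedBall_subset_closedBall (min_le_left _ _) (hsub n x hx))
    have := hΩ.add_mem h1 (hΩ.smul_mem_closure (Nat.cast_nonneg n) hx₀)
    simpa using this
  have hdisj : Pairwise (Function.onFun Disjoint s) := by
    intro i j hij
    refine Metric.closedBall_disjoint_closedBall ?_
    have h1 : dist (w + (i : ℝ) • x₀) (w + (j : ℝ) • x₀) = |(i : ℝ) - j| * ‖x₀‖ := by
      rw [dist_eq_norm, add_sub_add_left_eq_sub, ← sub_smul, norm_smul, Real.norm_eq_abs]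
    have h2 : (1 : ℝ) ≤ |(i : ℝ) - j| := by
      have : (1 : ℤ) ≤ |(i : ℤ) - j| := Int.one_le_abs (sub_ne_zero.2 (by exact_mod_cast hij))
      exact_mod_cast this
    rw [h1]
    have h3 : r ≤ ‖x₀‖ / 3 := min_le_right _ _
    nlinarith
  set K : ℝ := (‖w‖ + r) * ‖y‖
  have hlow : ∀ n, ∀ x ∈ s n, Real.exp (-K) ≤ Real.exp (-inner ℝ x y) := by
    intro n x hx
    gcongr
    have h1 := hsub n x hx
    have h2 : inner ℝ (x - (n : ℝ) • x₀) y ≤ ‖x - (n : ℝ) • x₀‖ * ‖y‖ := real_inner_le_norm _ _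
    have h3 : ‖x - (n : ℝ) • x₀‖ ≤ ‖w‖ + r := by
      calc ‖x - (n : ℝ) • x₀‖ = ‖w + (x - (n : ℝ) • x₀ - w)‖ := by congr 1; abel
        _ ≤ ‖w‖ + ‖x - (n : ℝ) • x₀ - w‖ := norm_add_le _ _
        _ ≤ ‖w‖ + r := by gcongr; simpa [dist_eq_norm] using h1
    have h4 : inner ℝ (x - (n : ℝ) • x₀) y = inner ℝ x y - n * inner ℝ x₀ y := by
      rw [inner_sub_left, real_inner_smul_left]
    have h5 : (n : ℝ) * inner ℝ x₀ y ≤ 0 :=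
      mul_nonpos_of_nonneg_of_nonpos (Nat.cast_nonneg n) hle
    have h6 : ‖x - (n : ℝ) • x₀‖ * ‖y‖ ≤ K := by simp only [K]; gcongr
    linarith
  refine top_le_iff.1 ?_
  calc (⊤ : ENNReal) = ∑' _ : ℕ, ENNReal.ofReal (Real.exp (-K)) *
        volume (Metric.closedBall (0 : V) r) :=
        (ENNReal.tsum_const_eq_top_of_ne_zero (mul_ne_zero
          (by simpa using Real.exp_pos _) (Metric.measure_closedBall_pos volume 0 hr).ne')).symm
    _ = ∑' n : ℕ, ∫⁻ _ in s n, ENNReal.ofReal (Real.exp (-K)) := by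
        congr 1; ext n
        rw [setLIntegral_const, ← Measure.addHaar_closedBall_center _ (w + (n : ℝ) • x₀)]
    _ ≤ ∑' n : ℕ, ∫⁻ x in s n, ENNReal.ofReal (Real.exp (-inner ℝ x y)) := by
        refine ENNReal.tsum_le_tsum fun n => setLIntegral_mono (by fun_prop) fun x hx => ?_
        exact ENNReal.ofReal_le_ofReal (hlow n x hx)
    _ = ∫⁻ x in ⋃ n, s n, ENNReal.ofReal (Real.exp (-inner ℝ x y)) :=
        (lintegral_iUnion (fun n => Metric.isClosed_closedBall.measurableSet) hdisj _).symm
    _ ≤ coneChar Ω y := lintegral_mono_set (Set.iUnion_subset hsΩ)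

/-- Change of variables by the adjoint of `g`, which maps Ω onto itself and has the same
determinant. -/
theorem coneChar_eq_mul [CompleteSpace V] {g : GLV V} (hg : g ∈ coneAut Ω) (y : V) :
    coneChar Ω y = ENNReal.ofReal |(g : V →L[ℝ] V).det| * coneChar Ω ((g : V →L[ℝ] V) y) := by
  let T : V →L[ℝ] V := star (g : V →L[ℝ] V)
  have hinj : Set.InjOn (T : V → V) Ω := by
    intro a _ b _ hab
    have h : ∀ x, ((star g)⁻¹ : GLV V).val (T x) = x := fun x => units_inv_apply_apply (star g) x
    rw [← h a, hab, h b]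
  have h := lintegral_image_eq_lintegral_abs_det_fderiv_mul volume hΩ.isOpen.measurableSet
    (f := T) (f' := fun _ => T) (fun x _ => T.hasFDerivWithinAt) hinj
    (fun x => ENNReal.ofReal (Real.exp (-inner ℝ x y)))
  have hs : (T : V → V) '' Ω = Ω := hΩ.star_mem hg
  rw [hs, lintegral_const_mul _ (by fun_prop), det_star_eq] at h
  simp only [T, ContinuousLinearMap.star_eq_adjoint,
    ContinuousLinearMap.adjoint_inner_left] at h
  exact h

end IsSymmetricCone

end CharacteristicFunction

/-! ### A base point whose stabiliser is the orthogonal part of the group -/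

section BasePoint

open Filter Topology

variable {V : Type*} [NormedAddCommGroup V] [InnerProductSpace ℝ V] [FiniteDimensional ℝ V]

/-- The characteristic function of a cone with real values. -/
noncomputable def coneCharReal [MeasurableSpace V] [BorelSpace V] (Ω : Set V) (y : V) : ℝ :=
  ∫ x in Ω, Real.exp (-inner ℝ x y)

theorem nonneg_of_forall_add_sq {a b : ℝ}
    (h : ∀ t : ℝ, 0 < t → t ≤ 1 → 0 ≤ t * a + t ^ 2 * b) : 0 ≤ a := by
  have h1 : Tendsto (fun t : ℝ => a + t * b) (𝓝[>] 0) (𝓝 (a + 0 * b)) :=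
    (Continuous.tendsto (by fun_prop) 0).mono_left nhdsWithin_le_nhds
  rw [zero_mul, add_zero] at h1
  refine ge_of_tendsto h1 ?_
  filter_upwards [Ioc_mem_nhdsGT (zero_lt_one' ℝ)] with t ht
  have h2 := h t ht.1 ht.2
  have h3 : t * a + t ^ 2 * b = t * (a + t * b) := by ring
  rw [h3] at h2
  exact nonneg_of_mul_nonneg_right h2 ht.1

namespace IsSymmetricCone

variable {Ω : Set V} (hΩ : IsSymmetricCone Ω)
include hΩ

section Measure

variable [MeasurableSpace V] [BorelSpace V]

theorem coneCharReal_convex {y z : V} (hy : y ∈ Ω) (hz : z ∈ Ω) {s t : ℝ} (hs : 0 ≤ s)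
    (ht : 0 ≤ t) (hst : s + t = 1) :
    coneCharReal Ω (s • y + t • z) ≤ s * coneCharReal Ω y + t * coneCharReal Ω z := by
  have hm : s • y + t • z ∈ Ω := hΩ.convex hy hz hs ht hst
  rw [coneCharReal, coneCharReal, coneCharReal, ← integral_const_mul, ← integral_const_mul,
    ← integral_add ((hΩ.integrableOn_exp hy).const_mul s) ((hΩ.integrableOn_exp hz).const_mul t)]
  refine integral_mono (hΩ.integrableOn_exp hm)
    (((hΩ.integrableOn_exp hy).const_mul s).add ((hΩ.integrableOn_exp hz).const_mul t))
    fun x => ?_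
  have := convexOn_exp.2 (Set.mem_univ (-inner ℝ x y)) (Set.mem_univ (-inner ℝ x z)) hs ht hst
  simp only [smul_eq_mul] at this
  refine le_trans (le_of_eq ?_) this
  rw [inner_add_right, inner_smul_right, inner_smul_right]
  congr 1; ring

/-- The convexity defect is the integral of (exp(-⟪x, y⟫/2) - exp(-⟪x, z⟫/2))². Were it zero, y - z
would be orthogonal to the open set Ω. -/
theorem coneCharReal_midpoint_lt {y z : V} (hy : y ∈ Ω) (hz : z ∈ Ω) (hyz : y ≠ z) :
    2 * coneCharReal Ω ((1 / 2 : ℝ) • y + (1 / 2 : ℝ) • z) <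
      coneCharReal Ω y + coneCharReal Ω z := by
  have hm : (1 / 2 : ℝ) • y + (1 / 2 : ℝ) • z ∈ Ω :=
    hΩ.convex hy hz (by norm_num) (by norm_num) (by norm_num)
  set f : V → ℝ := fun x => (Real.exp (-inner ℝ x y / 2) - Real.exp (-inner ℝ x z / 2)) ^ 2
  have hf : f = fun x => Real.exp (-inner ℝ x y) + Real.exp (-inner ℝ x z) -
      2 * Real.exp (-inner ℝ x ((1 / 2 : ℝ) • y + (1 / 2 : ℝ) • z)) := by
    ext x
    simp only [f, sub_sq, ← Real.exp_nat_mul, mul_assoc, ← Real.exp_add]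
    rw [inner_add_right, inner_smul_right, inner_smul_right]
    push_cast
    ring_nf
  have hi1 := (hΩ.integrableOn_exp hy).add (hΩ.integrableOn_exp hz)
  have hi2 := (hΩ.integrableOn_exp hm).const_mul 2
  have hint : IntegrableOn f Ω := by rw [hf]; exact hi1.sub hi2
  have hval : ∫ x in Ω, f x = coneCharReal Ω y + coneCharReal Ω z -
      2 * coneCharReal Ω ((1 / 2 : ℝ) • y + (1 / 2 : ℝ) • z) := by
    rw [hf]
    refine (integral_sub hi1 hi2).trans ?_
    rw [integral_const_mul]
    exact congrArg (· - _) (integral_add (hΩ.integrableOn_exp hy) (hΩ.integrableOn_exp hz))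
  have hpos : 0 < ∫ x in Ω, f x := by
    rw [setIntegral_pos_iff_support_of_nonneg_ae (ae_of_all _ fun x => sq_nonneg _) hint]
    have hopen : IsOpen (Function.support f ∩ Ω) := by
      refine IsOpen.inter ?_ hΩ.isOpen
      have : Continuous f := by fun_prop
      exact this.isOpen_support
    refine hopen.measure_pos _ ?_
    by_contra hne
    rw [Set.not_nonempty_iff_eq_empty] at hne
    have horth : ∀ x ∈ Ω, inner ℝ x (y - z) = 0 := by
      intro x hx
      have : f x = 0 := by
        by_contra h0
        have : x ∈ Function.support f ∩ Ω := ⟨h0, hx⟩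
        simp [hne] at this
      have := sub_eq_zero.1 (pow_eq_zero_iff (two_ne_zero) |>.1 this)
      have := Real.exp_injective this
      rw [inner_sub_right]; linarith
    obtain ⟨δ, hδ, hb⟩ := hΩ.exists_closedBall_subset hy
    have hd : y - z ≠ 0 := sub_ne_zero.2 hyz
    have hd' : 0 < ‖y - z‖ := norm_pos_iff.2 hd
    have h1 : y + (δ * ‖y - z‖⁻¹) • (y - z) ∈ Ω := by
      apply hb
      simp only [Metric.mem_closedBall, dist_self_add_left, norm_smul, norm_mul, norm_inv,
        norm_norm, Real.norm_of_nonneg hδ.le]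
      field_simp; rfl
    have h2 := horth _ h1
    rw [inner_add_left, horth y hy, zero_add, real_inner_smul_left,
      real_inner_self_eq_norm_sq] at h2
    have : 0 < δ * ‖y - z‖⁻¹ * ‖y - z‖ ^ 2 := by positivity
    linarith
  linarith

theorem coneCharReal_eq_toReal {y : V} (hy : y ∈ Ω) :
    coneCharReal Ω y = (coneChar Ω y).toReal := by
  rw [hΩ.coneChar_eq_ofReal hy, ENNReal.toReal_ofReal]
  · rfl
  · exact integral_nonneg fun x => (Real.exp_pos _).le

theorem coneCharReal_pos {y : V} (hy : y ∈ Ω) : 0 < coneCharReal Ω y := by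
  rw [hΩ.coneCharReal_eq_toReal hy]
  exact ENNReal.toReal_pos (hΩ.coneChar_pos y) (hΩ.coneChar_ne_top hy)

theorem coneCharReal_eq_mul [CompleteSpace V] {g : GLV V} (hg : g ∈ coneAut Ω) {y : V}
    (hy : y ∈ Ω) :
    coneCharReal Ω y = |(g : V →L[ℝ] V).det| * coneCharReal Ω ((g : V →L[ℝ] V) y) := by
  rw [hΩ.coneCharReal_eq_toReal hy, hΩ.coneCharReal_eq_toReal (map_mem_of_mem_coneAut hg hy),
    hΩ.coneChar_eq_mul hg y, ENNReal.toReal_mul, ENNReal.toReal_ofReal (abs_nonneg _)]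

/-- φ is lower semicontinuous and infinite off Ω, so a minimiser over a closed ball of V
automatically lies in Ω; the quadratic term makes the problem coercive. -/
theorem exists_isMinOn_coneCharReal :
    ∃ e ∈ Ω, ∀ y ∈ Ω, coneCharReal Ω e + ‖e‖ ^ 2 / 2 ≤ coneCharReal Ω y + ‖y‖ ^ 2 / 2 := by
  obtain ⟨y₀, hy₀⟩ := hΩ.nonempty
  set f : V → ENNReal := fun y => coneChar Ω y + ENNReal.ofReal (‖y‖ ^ 2 / 2)
  have hlsc : LowerSemicontinuous f :=
    (lowerSemicontinuous_coneChar Ω).add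
      (ENNReal.continuous_ofReal.comp (by fun_prop)).lowerSemicontinuous
  have hfreal : ∀ y ∈ Ω, f y = ENNReal.ofReal (coneCharReal Ω y + ‖y‖ ^ 2 / 2) := by
    intro y hy
    rw [ENNReal.ofReal_add (hΩ.coneCharReal_pos hy).le (by positivity)]
    simp only [f]
    rw [hΩ.coneChar_eq_ofReal hy]; rfl
  set A : ℝ := coneCharReal Ω y₀ + ‖y₀‖ ^ 2 / 2
  have hA : 0 < A := by have := hΩ.coneCharReal_pos hy₀; positivity
  -- Large enough that `y₀` is in the ball and that the quadratic term alone exceeds the value `A`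
  -- at `y₀` outside it.
  set R : ℝ := ‖y₀‖ + 2 * A + 2
  have hR : A < R ^ 2 / 2 := by
    have : 0 ≤ ‖y₀‖ := norm_nonneg _
    simp only [R]; nlinarith
  obtain ⟨e, heR, he⟩ := LowerSemicontinuousOn.exists_isMinOn (s := Metric.closedBall (0 : V) R)
    (f := f) ⟨y₀, by simp [R]; linarith⟩ (isCompact_closedBall _ _) (hlsc.lowerSemicontinuousOn _)
  have hey₀ : f e ≤ f y₀ := he (show y₀ ∈ Metric.closedBall (0 : V) R by simp [R]; linarith)
  have heΩ : e ∈ Ω := by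
    by_contra h
    have h1 : f e = ⊤ := by simp [f, hΩ.coneChar_eq_top h]
    rw [h1, hfreal y₀ hy₀] at hey₀
    simp at hey₀
  refine ⟨e, heΩ, fun y hy => ?_⟩
  have hpos : ∀ y ∈ Ω, 0 ≤ coneCharReal Ω y + ‖y‖ ^ 2 / 2 := fun y hy => by
    have := hΩ.coneCharReal_pos hy; positivity
  rcases le_or_gt ‖y‖ R with h | h
  · have h1 : f e ≤ f y := he (by simpa using h)
    rw [hfreal y hy, hfreal e heΩ] at h1
    exact (ENNReal.ofReal_le_ofReal_iff (hpos y hy)).1 h1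
  · rw [hfreal y₀ hy₀, hfreal e heΩ] at hey₀
    have h1 := (ENNReal.ofReal_le_ofReal_iff hA.le).1 hey₀
    have h2 := hΩ.coneCharReal_pos hy
    have h3 : R ^ 2 ≤ ‖y‖ ^ 2 := by
      have : 0 ≤ R := by positivity
      gcongr
    linarith

/-- First variation at the minimiser: -e is a subgradient of φ at e. Convexity suffices, so φ need
not be differentiated. -/
theorem coneCharReal_ge_of_isMin {e : V} (he : e ∈ Ω)
    (hmin : ∀ y ∈ Ω, coneCharReal Ω e + ‖e‖ ^ 2 / 2 ≤ coneCharReal Ω y + ‖y‖ ^ 2 / 2)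
    {y : V} (hy : y ∈ Ω) : coneCharReal Ω e - inner ℝ e (y - e) ≤ coneCharReal Ω y := by
  have := nonneg_of_forall_add_sq (a := coneCharReal Ω y - coneCharReal Ω e + inner ℝ e (y - e))
    (b := ‖y - e‖ ^ 2 / 2) fun t ht0 ht1 => by
      have h1 := hΩ.coneCharReal_convex he hy (s := 1 - t) (t := t) (by linarith) ht0.le (by ring)
      have h2 := hmin _ (hΩ.convex he hy (show 0 ≤ 1 - t by linarith) ht0.le (by ring))
      have h3 : (1 - t) • e + t • y = e + t • (y - e) := by
        rw [sub_smul, one_smul, smul_sub]; abel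
      have h4 : ‖(1 - t) • e + t • y‖ ^ 2 =
          ‖e‖ ^ 2 + 2 * (t * inner ℝ e (y - e)) + t ^ 2 * ‖y - e‖ ^ 2 := by
        rw [h3, norm_add_sq_real, inner_smul_right, norm_smul, mul_pow, Real.norm_eq_abs, sq_abs]
      rw [h4] at h2
      linarith
  linarith

end Measure

theorem exists_mem_stabilizer_le_orthGroup [CompleteSpace V] : ∃ e ∈ Ω,
    (∀ g ∈ coneAut Ω, (g : V →L[ℝ] V) e = e → g ∈ orthGroup V) ∧
    ∀ g ∈ coneAut Ω, g ∈ orthGroup V → (g : V →L[ℝ] V) e = e := by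
  let _ : MeasurableSpace V := borel V
  have _ : BorelSpace V := ⟨rfl⟩
  obtain ⟨e, he, hmin⟩ := hΩ.exists_isMinOn_coneCharReal
  have hstar : ∀ g ∈ coneAut Ω, (g : V →L[ℝ] V) e = e → (star g : GLV V).val e = e := by
    intro g hg hge
    have hinv : ((g⁻¹ : GLV V) : V →L[ℝ] V) e = e := by
      conv_lhs => rw [← hge]
      simp
    have hθ : (star g)⁻¹ ∈ coneAut Ω := inv_mem (hΩ.star_mem hg)
    have hinv' := inv_mem hg
    set u : V := ((star g)⁻¹ : GLV V).val e with hu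
    have hu' : u ∈ Ω := map_mem_of_mem_coneAut hθ he
    -- Here φ(u) = φ(e) because |det g| = 1, and ⟪e, u⟫ = ⟪g⁻¹ e, e⟫ = ⟪e, e⟫. The subgradient bound
    -- at the midpoint of e and u then contradicts strict convexity unless u = e.
    have hue : u = e := by
      by_contra hne
      have hdet : |((g⁻¹ : GLV V) : V →L[ℝ] V).det| = 1 := by
        have h1 := hΩ.coneCharReal_eq_mul hinv' he
        rw [hinv] at h1
        have h2 := hΩ.coneCharReal_pos he
        nlinarith
      have h1 := hΩ.coneCharReal_eq_mul hθ he
      rw [← star_inv, Units.coe_star, det_star_eq, hdet, one_mul, ← Units.coe_star, star_inv,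
        ← hu] at h1
      have h2 := hΩ.coneCharReal_midpoint_lt he hu' (Ne.symm hne)
      have hm : (1 / 2 : ℝ) • e + (1 / 2 : ℝ) • u ∈ Ω :=
        hΩ.convex he hu' (by norm_num) (by norm_num) (by norm_num)
      have h3 := hΩ.coneCharReal_ge_of_isMin he hmin hm
      have h4 : inner ℝ e u = inner ℝ e e := by
        rw [hu, inner_inv_star_apply, hinv]
      have h5 : inner ℝ e ((1 / 2 : ℝ) • e + (1 / 2 : ℝ) • u - e) = 0 := by
        rw [inner_sub_right, inner_add_right, inner_smul_right, inner_smul_right, h4]; ring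
      rw [h5] at h3
      linarith
    have := units_apply_inv_apply (star g) e
    rw [← hu, hue] at this
    exact this
  refine ⟨e, he, fun g hg hge => ?_, fun g hg hgo => ?_⟩
  · obtain ⟨δ, hδ, hb⟩ := hΩ.exists_closedBall_subset he
    have hle : ∀ g ∈ coneAut Ω, (g : V →L[ℝ] V) e = e → ‖(g : V →L[ℝ] V)‖ ≤ 1 := by
      intro g hg hge
      set T : V →L[ℝ] V := star (g : V →L[ℝ] V) * g with hT
      have hTsa : IsSelfAdjoint T := IsSelfAdjoint.star_mul_self _
      have hTe : ∀ n : ℕ, (T ^ n) e = e := by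
        intro n
        induction n with
        | zero => simp
        | succ n ih =>
          rw [pow_succ, mul_apply_eq_comp, hT, mul_apply_eq_comp, hge, ← hT, ← Units.coe_star,
            hstar g hg hge, ih]
      have hTmem : T ∈ closureEnd Ω :=
        mul_mem (coe_mem_closureEnd (hΩ.star_mem hg)) (coe_mem_closureEnd hg)
      -- Powers of T = g* g preserve the cone and fix e, hence are uniformly bounded; since T is
      -- self-adjoint, its norm is multiplicative on the powers 2ⁿ, which forces ‖T‖ ≤ 1.
      have hbd : ∀ n : ℕ, ‖T‖ ^ 2 ^ n ≤ δ⁻¹ * ‖e‖ := by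
        intro n
        have h1 := hΩ.opNorm_le (pow_mem hTmem (2 ^ n)) hδ hb
        rwa [hTe, hTsa.norm_pow_two_pow] at h1
      have hT1 : ‖T‖ ≤ 1 := by
        by_contra! h
        have := (tendsto_pow_atTop_atTop_of_one_lt h).comp
          (tendsto_pow_atTop_atTop_of_one_lt (one_lt_two (α := ℕ)))
        obtain ⟨n, hn⟩ := (this.eventually_gt_atTop (δ⁻¹ * ‖e‖)).exists
        exact absurd (hbd n) (not_le.2 hn)
      have h2 : ‖T‖ = ‖(g : V →L[ℝ] V)‖ * ‖(g : V →L[ℝ] V)‖ := CStarRing.norm_star_mul_self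
      rw [h2] at hT1
      nlinarith [norm_nonneg (g : V →L[ℝ] V)]
    have hinv : ((g⁻¹ : GLV V) : V →L[ℝ] V) e = e := by
      conv_lhs => rw [← hge]
      simp
    intro x
    refine le_antisymm ?_ ?_
    · simpa using (g : V →L[ℝ] V).le_of_opNorm_le (hle g hg hge) x
    · simpa using ((g⁻¹ : GLV V) : V →L[ℝ] V).le_of_opNorm_le (hle _ (inv_mem hg) hinv)
        ((g : V →L[ℝ] V) x)
  -- Conversely, φ + ‖·‖²/2 takes the same value at e and g e when g is orthogonal, and a smaller
  -- one at their midpoint.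
  · by_contra hne
    have hge := map_mem_of_mem_coneAut hg he
    have hdet : |(g : V →L[ℝ] V).det| = 1 := by
      have h1 := congrArg (fun u : GLV V => (u : V →L[ℝ] V).det) (mem_orthGroup_iff.1 hgo)
      have h2 : ((star g * g : GLV V) : V →L[ℝ] V).det =
          (star (g : V →L[ℝ] V)).det * (g : V →L[ℝ] V).det := by
        change LinearMap.det _ = LinearMap.det _ * LinearMap.det _
        rw [← LinearMap.det_comp]; rfl
      have h3 : ((1 : GLV V) : V →L[ℝ] V).det = 1 := LinearMap.det_id
      rw [h2, h3, det_star_eq] at h1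
      exact (abs_eq (zero_le_one' ℝ)).2 (mul_self_eq_one_iff.1 h1)
    have h1 := hΩ.coneCharReal_eq_mul hg he
    rw [hdet, one_mul] at h1
    have h2 := hΩ.coneCharReal_midpoint_lt he hge (Ne.symm hne)
    have hm : (1 / 2 : ℝ) • e + (1 / 2 : ℝ) • (g : V →L[ℝ] V) e ∈ Ω :=
      hΩ.convex he hge (by norm_num) (by norm_num) (by norm_num)
    have h3 := hmin _ hm
    have h4 : ‖(1 / 2 : ℝ) • e + (1 / 2 : ℝ) • (g : V →L[ℝ] V) e‖ ≤ ‖e‖ := by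
      refine (norm_add_le _ _).trans ?_
      rw [norm_smul, norm_smul, hgo e]
      norm_num; linarith
    have h5 : ‖(1 / 2 : ℝ) • e + (1 / 2 : ℝ) • (g : V →L[ℝ] V) e‖ ^ 2 ≤ ‖e‖ ^ 2 := by gcongr
    linarith

end IsSymmetricCone

end BasePoint

/-! ### Derivatives of products and conjugates of exponentials -/

section BanachAlgebra

open NormedSpace

variable {𝔸 : Type*} [NormedRing 𝔸] [NormedAlgebra ℝ 𝔸] [CompleteSpace 𝔸]

theorem hasDerivAt_exp_smul_mul_exp_smul (x y : 𝔸) :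
    HasDerivAt (fun t : ℝ => exp (t • x) * exp (t • y)) (x + y) 0 := by
  simpa using! (hasDerivAt_exp_smul_zero x).mul (hasDerivAt_exp_smul_zero y)

theorem hasDerivAt_exp_smul_conj (x y : 𝔸) :
    HasDerivAt (fun t : ℝ => exp (t • x) * y * exp (-(t • x))) ⁅x, y⁆ 0 := by
  have h2 : HasDerivAt (fun t : ℝ => exp (-(t • x))) (-x) 0 := by
    simpa using hasDerivAt_exp_smul_zero (-x)
  have h3 := ((hasDerivAt_exp_smul_zero x).mul_const y).mul h2
  simpa [Ring.lie_def, sub_eq_add_neg] using! h3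

end BanachAlgebra

/-! ### The Lie algebra of the automorphism group and infinitesimal transitivity -/

section LieAlgebra

open Filter Topology NormedSpace

variable {V : Type*} [NormedAddCommGroup V] [InnerProductSpace ℝ V] {Ω : Set V}

/-- A near-minimiser, available without any compactness of `S`. -/
theorem exists_forall_le_two_mul {S : Type*} [Nonempty S] {f : S → ℝ} {c : ℝ} (hc : 0 < c)
    (hf : ∀ s, c ≤ f s) : ∃ s, ∀ s', f s ≤ 2 * f s' := by
  have hb : BddBelow (Set.range f) := ⟨c, by rintro _ ⟨s, rfl⟩; exact hf s⟩
  have h0 : c ≤ ⨅ s, f s := le_ciInf hf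
  obtain ⟨s, hs⟩ := exists_lt_of_ciInf_lt (show ⨅ s, f s < 2 * ⨅ s, f s by linarith)
  exact ⟨s, fun s' => hs.le.trans (by have := ciInf_le hb s'; linarith)⟩

variable [CompleteSpace V]

theorem mem_coneLie_iff {X : V →L[ℝ] V} :
    X ∈ coneLie Ω ↔ ∀ t : ℝ, expUnit (t • X) ∈ coneAut Ω := by
  refine forall_congr' fun t => ⟨?_, fun h => ⟨_, h, rfl⟩⟩
  rintro ⟨g, hg, h⟩
  have : expUnit (t • X) = g := Units.ext h.symm
  rwa [this]

theorem expUnit_mem_coneAut {X : V →L[ℝ] V} (hX : X ∈ coneLie Ω) : expUnit X ∈ coneAut Ω := by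
  simpa using mem_coneLie_iff.1 hX 1

theorem smul_mem_coneLie {X : V →L[ℝ] V} (hX : X ∈ coneLie Ω) (c : ℝ) : c • X ∈ coneLie Ω := by
  rw [mem_coneLie_iff] at hX ⊢
  intro t
  rw [smul_smul]
  exact hX _

theorem exp_apply_eq_self {X : V →L[ℝ] V} {e : V} (h : X e = 0) : exp X e = e := by
  have hd : ∀ t : ℝ, HasDerivAt (fun t : ℝ => exp (t • X) e) 0 t := by
    intro t
    have h1 := (hasDerivAt_exp_smul_const (𝕂 := ℝ) X t).clm_apply (hasDerivAt_const t e)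
    simpa [h] using h1
  have := is_const_of_deriv_eq_zero (fun t => (hd t).differentiableAt) (fun t => (hd t).deriv) 1 0
  simpa using this

theorem conj_mem_coneLie {X : V →L[ℝ] V} (hX : X ∈ coneLie Ω) {g : GLV V} (hg : g ∈ coneAut Ω) :
    (g : V →L[ℝ] V) * X * ((g⁻¹ : GLV V) : V →L[ℝ] V) ∈ coneLie Ω := by
  rw [mem_coneLie_iff] at hX ⊢
  intro t
  have : expUnit (t • ((g : V →L[ℝ] V) * X * ((g⁻¹ : GLV V) : V →L[ℝ] V))) =
      g * expUnit (t • X) * g⁻¹ := by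
    ext1
    rw [val_expUnit, Units.val_mul, Units.val_mul, val_expUnit, ← exp_units_conj_real]
    simp
  rw [this]
  exact mul_mem (mul_mem hg (hX t)) (inv_mem hg)

theorem tendsto_units_inv_of_tendsto_one {ι : Type*} {l : Filter ι} {g : ι → GLV V}
    (h : Tendsto (fun i => (g i : V →L[ℝ] V)) l (𝓝 1)) :
    Tendsto (fun i => ((g i)⁻¹ : GLV V).val) l (𝓝 1) := by
  have := (NormedRing.inverse_continuousAt (1 : GLV V)).tendsto.comp h
  simpa [Function.comp_def] using this

omit [CompleteSpace V] in
theorem tendsto_of_tendsto_slope {ι : Type*} {l : Filter ι} {a : ι → V →L[ℝ] V} {t : ι → ℝ}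
    {X : V →L[ℝ] V} (ht : ∀ᶠ i in l, 0 < t i) (ht0 : Tendsto t l (𝓝 0))
    (hX : Tendsto (fun i => (t i)⁻¹ • (a i - 1)) l (𝓝 X)) : Tendsto a l (𝓝 1) := by
  have h1 := (ht0.smul hX).add_const 1
  rw [zero_smul, zero_add] at h1
  refine h1.congr' ?_
  filter_upwards [ht] with i hi
  rw [smul_smul, mul_inv_cancel₀ hi.ne', one_smul, sub_add_cancel]

theorem star_expUnit (X : V →L[ℝ] V) : star (expUnit X) = expUnit (star X) :=
  Units.ext (star_exp X)

namespace IsSymmetricCone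

variable (hΩ : IsSymmetricCone Ω)
include hΩ

/-- The inverses have tangent vector -X, so the semigroup statement for closed monoids applies to
both directions of time. -/
theorem mem_coneLie_of_tendsto {ι : Type*} {l : Filter ι} [NeBot l] {g : ι → GLV V} {t : ι → ℝ}
    {X : V →L[ℝ] V} (hg : ∀ᶠ i in l, g i ∈ coneAut Ω) (ht : ∀ᶠ i in l, 0 < t i)
    (ht0 : Tendsto t l (𝓝 0))
    (hX : Tendsto (fun i => (t i)⁻¹ • ((g i : V →L[ℝ] V) - 1)) l (𝓝 X)) : X ∈ coneLie Ω := by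
  have h1 : ‖(1 : V →L[ℝ] V)‖ ≤ 1 := ContinuousLinearMap.norm_id_le
  have hinv : Tendsto (fun i => (t i)⁻¹ • (((g i)⁻¹ : GLV V).val - 1)) l (𝓝 (-X)) := by
    have h2 := tendsto_units_inv_of_tendsto_one (tendsto_of_tendsto_slope ht ht0 hX)
    have h3 := (h2.mul hX).neg
    rw [one_mul] at h3
    refine h3.congr fun i => ?_
    rw [mul_smul_comm, ← smul_neg, mul_sub, Units.inv_mul, mul_one, neg_sub]
  have key : ∀ s : ℝ, 0 ≤ s → exp (s • X) ∈ closureEnd Ω ∧ exp (s • (-X)) ∈ closureEnd Ω :=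
    fun s hs => ⟨exp_smul_mem_of_tendsto h1 isClosed_closureEnd
      (hg.mono fun i hi => coe_mem_closureEnd hi) ht ht0 hX hs,
      exp_smul_mem_of_tendsto h1 isClosed_closureEnd
      (hg.mono fun i hi => coe_mem_closureEnd (inv_mem hi)) ht ht0 hinv hs⟩
  rw [mem_coneLie_iff]
  intro s
  rw [hΩ.mem_coneAut_iff, val_expUnit, val_inv_expUnit]
  rcases le_total 0 s with hs | hs
  · have := key s hs
    rwa [smul_neg] at this
  · have := key (-s) (by linarith)
    rw [smul_neg, neg_smul, neg_neg] at this
    exact this.symm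

/-- The Lie algebra of the automorphism group of a symmetric cone as a vector space. -/
def lie : Submodule ℝ (V →L[ℝ] V) where
  carrier := coneLie Ω
  zero_mem' := by
    rw [mem_coneLie_iff]; intro t; simp [one_mem]
  smul_mem' := fun c _ hX => smul_mem_coneLie hX c
  add_mem' := by
    intro X Y hX hY
    have hd : HasDerivAt (fun t : ℝ => exp (t • X) * exp (t • Y)) (X + Y) 0 :=
      hasDerivAt_exp_smul_mul_exp_smul X Y
    refine hΩ.mem_coneLie_of_tendsto (l := 𝓝[>] (0 : ℝ)) (t := id)
      (g := fun t => expUnit (t • X) * expUnit (t • Y)) (Eventually.of_forall fun t =>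
        mul_mem (mem_coneLie_iff.1 hX t) (mem_coneLie_iff.1 hY t))
      eventually_mem_nhdsWithin (tendsto_id.mono_left nhdsWithin_le_nhds) ?_
    simpa using! hd.tendsto_slope_zero_right

theorem mem_lie {X : V →L[ℝ] V} : X ∈ hΩ.lie ↔ X ∈ coneLie Ω := Iff.rfl

theorem star_mem_lie {X : V →L[ℝ] V} (hX : X ∈ hΩ.lie) : star X ∈ hΩ.lie := by
  rw [mem_lie, mem_coneLie_iff] at hX ⊢
  intro t
  have : expUnit (t • star X) = star (expUnit (t • X)) := by
    rw [star_expUnit, star_smul, star_trivial t]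
  rw [this]
  exact hΩ.star_mem (hX t)

/-- The bracket is the derivative of Ad(exp(tX)) Y, a curve in a closed subspace. -/
theorem bracket_mem_lie [FiniteDimensional ℝ V] {X Y : V →L[ℝ] V} (hX : X ∈ hΩ.lie)
    (hY : Y ∈ hΩ.lie) : ⁅X, Y⁆ ∈ hΩ.lie := by
  have hd : HasDerivAt (fun t : ℝ => exp (t • X) * Y * exp (-(t • X))) ⁅X, Y⁆ 0 :=
    hasDerivAt_exp_smul_conj X Y
  have hclosed : IsClosed (hΩ.lie : Set (V →L[ℝ] V)) := hΩ.lie.closed_of_finiteDimensional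
  refine hclosed.mem_of_tendsto hd.tendsto_slope_zero_right (Eventually.of_forall fun t => ?_)
  refine hΩ.lie.smul_mem _ (hΩ.lie.sub_mem ?_ ?_)
  · have := conj_mem_coneLie hY (mem_coneLie_iff.1 hX (0 + t))
    simpa using! this
  · simpa using hY

/-- Transitivity moves e to points e + t w with t → 0. Automorphisms doing this and nearly closest
to 1 have, after normalisation, a limiting direction X in the Lie algebra with X e a multiple of w.
Near-minimality rules out X e = 0. -/
theorem exists_mem_lie_apply_eq [FiniteDimensional ℝ V] {e : V} (he : e ∈ Ω) (v : V) :
    ∃ X ∈ hΩ.lie, X e = v := by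
  rcases eq_or_ne v 0 with rfl | hv
  · exact ⟨0, zero_mem _, rfl⟩
  obtain ⟨δ, hδ, hb⟩ := hΩ.exists_closedBall_subset he
  have hv' : 0 < ‖v‖ := norm_pos_iff.2 hv
  set w : V := (δ / 2 * ‖v‖⁻¹) • v with hwdef
  have hw : ‖w‖ = δ / 2 := by
    simp only [w, norm_smul, norm_mul, norm_inv, norm_norm, norm_div,
      Real.norm_of_nonneg hδ.le, Real.norm_ofNat]
    field_simp
  set t : ℕ → ℝ := fun n => 1 / ((n : ℝ) + 1) with htdef
  have htpos : ∀ n, 0 < t n := fun n => Nat.one_div_pos_of_nat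
  have ht1 : ∀ n, t n ≤ 1 := fun n => by
    simp only [t]; rw [div_le_one (by positivity)]; linarith [Nat.cast_nonneg (α := ℝ) n]
  have ht0 : Tendsto t atTop (𝓝 0) := tendsto_one_div_add_atTop_nhds_zero_nat
  set x : ℕ → V := fun n => e + t n • w with hxdef
  have hxe : ∀ n, dist (x n) e ≤ δ / 2 := fun n => by
    simp only [x, dist_self_add_left, norm_smul, hw, Real.norm_of_nonneg (htpos n).le]
    nlinarith [ht1 n]
  have hxΩ : ∀ n, x n ∈ Ω := fun n => hb (by
    rw [Metric.mem_closedBall]; linarith [hxe n])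
  have hxb : ∀ n, Metric.closedBall (x n) (δ / 2) ⊆ Ω := fun n =>
    (Metric.closedBall_subset_closedBall' (by linarith [hxe n])).trans hb
  have hsel : ∀ n, ∃ g : {g : GLV V // g ∈ coneAut Ω ∧ g.val e = x n},
      ∀ g' : {g : GLV V // g ∈ coneAut Ω ∧ g.val e = x n},
        ‖g.1.val - 1‖ ≤ 2 * ‖g'.1.val - 1‖ := by
    intro n
    obtain ⟨g, hg, hge⟩ := hΩ.transitive e he (x n) (hxΩ n)
    have : Nonempty {g : GLV V // g ∈ coneAut Ω ∧ g.val e = x n} := ⟨⟨g, hg, hge⟩⟩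
    -- From ‖(g - 1) e‖ = t ‖w‖; adding 1 to ‖e‖ only avoids a zero denominator.
    have hc : 0 < t n * (δ / 2) / (‖e‖ + 1) := by have := htpos n; positivity
    refine exists_forall_le_two_mul hc fun s => ?_
    rw [div_le_iff₀ (by positivity)]
    have h1 := (s.1.val - 1).le_opNorm e
    have h2 : (s.1.val - 1) e = t n • w := by
      simp [s.2.2, x]
    rw [h2, norm_smul, hw, Real.norm_of_nonneg (htpos n).le] at h1
    nlinarith [norm_nonneg (s.1.val - 1)]
  choose g' hg' using hsel
  set g : ℕ → GLV V := fun n => (g' n).1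
  have hgG : ∀ n, g n ∈ coneAut Ω := fun n => (g' n).2.1
  have hge : ∀ n, (g n).val e = x n := fun n => (g' n).2.2
  have hmin : ∀ n, ∀ h ∈ coneAut Ω, h.val e = x n → ‖(g n).val - 1‖ ≤ 2 * ‖h.val - 1‖ :=
    fun n h h1 h2 => hg' n ⟨h, h1, h2⟩
  have hpos : ∀ n, 0 < ‖(g n).val - 1‖ := by
    intro n
    rw [norm_pos_iff, sub_ne_zero]
    intro h
    have h1 := hge n
    rw [h, one_apply_eq_self] at h1
    have h2 : t n • w = 0 := by simpa [x] using h1.symm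
    rcases smul_eq_zero.1 h2 with h3 | h3
    · exact (htpos n).ne' h3
    · rw [h3, norm_zero] at hw; linarith
  -- extract a subsequence tending to `1`
  set K : ℝ := max (δ⁻¹ * (‖e‖ + δ)) ((δ / 2)⁻¹ * ‖e‖)
  have hbd : ∀ n, ((g n).val, ((g n)⁻¹ : GLV V).val) ∈
      Metric.closedBall ((0 : V →L[ℝ] V), (0 : V →L[ℝ] V)) K := by
    intro n
    refine mem_closedBall_zero_iff.2 ?_
    rw [Prod.norm_def, max_le_iff]
    constructor
    · refine (hΩ.opNorm_le (coe_mem_closureEnd (hgG n)) hδ hb).trans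
        (le_trans ?_ (le_max_left _ _))
      rw [hge]
      gcongr
      calc ‖x n‖ = ‖e + (x n - e)‖ := by simp
        _ ≤ ‖e‖ + ‖x n - e‖ := norm_add_le _ _
        _ ≤ ‖e‖ + δ := by
          have := hxe n
          rw [dist_eq_norm] at this
          linarith
    · refine (hΩ.opNorm_le (coe_mem_closureEnd (inv_mem (hgG n))) (by positivity) (hxb n)).trans
        (le_trans (le_of_eq ?_) (le_max_right _ _))
      rw [← hge, units_inv_apply_apply]
  obtain ⟨⟨A, B⟩, -, φ, hφ, hlim⟩ := (isCompact_closedBall _ _).tendsto_subseq hbd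
  have hA : Tendsto (fun n => (g (φ n)).val) atTop (𝓝 A) :=
    (continuous_fst.tendsto _).comp hlim
  have hB : Tendsto (fun n => ((g (φ n))⁻¹ : GLV V).val) atTop (𝓝 B) :=
    (continuous_snd.tendsto _).comp hlim
  have hAB : A * B = 1 := tendsto_nhds_unique (hA.mul hB) (by simp)
  have hBA : B * A = 1 := tendsto_nhds_unique (hB.mul hA) (by simp)
  let T : GLV V := ⟨A, B, hAB, hBA⟩
  have hT : T ∈ coneAut Ω := hΩ.mem_coneAut_iff.2
    ⟨isClosed_closureEnd.mem_of_tendsto hA (Eventually.of_forall fun n =>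
      coe_mem_closureEnd (hgG _)), isClosed_closureEnd.mem_of_tendsto hB
      (Eventually.of_forall fun n => coe_mem_closureEnd (inv_mem (hgG _)))⟩
  have hTe : T.val e = e := by
    have h1 : Tendsto (fun n => (g (φ n)).val e) atTop (𝓝 (A e)) :=
      ((continuous_eval_const e).tendsto A).comp hA
    have h2 : Tendsto (fun n => (g (φ n)).val e) atTop (𝓝 e) := by
      simp only [hge, x]
      simpa using ((ht0.comp hφ.tendsto_atTop).smul_const w).const_add e
    exact tendsto_nhds_unique h1 h2
  have hTe' : (T⁻¹ : GLV V).val e = e := by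
    conv_lhs => rw [← hTe]
    simp
  set s : ℕ → ℝ := fun n => ‖(g (φ n)).val - 1‖
  -- The limit T fixes e, so multiplying by T⁻¹ on the right gives competitors tending to 1; by
  -- near-minimality the chosen sequence tends to 1 as well.
  have hs0 : Tendsto s atTop (𝓝 0) := by
    have h1 : Tendsto (fun n => 2 * ‖(g (φ n) * T⁻¹ : GLV V).val - 1‖) atTop (𝓝 0) := by
      have h2 : Tendsto (fun n => (g (φ n) * T⁻¹ : GLV V).val - 1) atTop (𝓝 (A * B - 1)) :=
        (hA.mul_const B).sub_const 1
      rw [hAB, sub_self] at h2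
      simpa using h2.norm.const_mul 2
    refine squeeze_zero (fun n => norm_nonneg _) (fun n => ?_) h1
    refine hmin _ _ (mul_mem (hgG _) (inv_mem hT)) ?_
    rw [units_mul_apply, hTe', hge]
  -- extract a limit direction
  have hsph : ∀ n, (s n)⁻¹ • ((g (φ n)).val - 1) ∈ Metric.sphere (0 : V →L[ℝ] V) 1 := by
    intro n
    have := hpos (φ n)
    simp only [mem_sphere_zero_iff_norm, norm_smul, norm_inv, s, norm_norm]
    field_simp
  obtain ⟨X, hX1, ψ, hψ, hXlim⟩ := (isCompact_sphere _ _).tendsto_subseq hsph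
  have hX1 : ‖X‖ = 1 := by simpa using hX1
  have hs0' : Tendsto (s ∘ ψ) atTop (𝓝 0) := hs0.comp hψ.tendsto_atTop
  have hspos : ∀ n, 0 < (s ∘ ψ) n := fun n => hpos _
  have hXlie : X ∈ coneLie Ω := hΩ.mem_coneLie_of_tendsto (l := atTop) (t := s ∘ ψ)
    (g := fun n => g (φ (ψ n))) (Eventually.of_forall fun n => hgG _)
    (Eventually.of_forall hspos) hs0' hXlim
  have hXe : X e ∈ Submodule.span ℝ {w} := by
    have hcl : IsClosed (Submodule.span ℝ {w} : Set V) :=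
      (Submodule.span ℝ {w}).closed_of_finiteDimensional
    have h1 := ((continuous_eval_const e).tendsto X).comp hXlim
    refine hcl.mem_of_tendsto h1 (Eventually.of_forall fun n => ?_)
    simp only [Function.comp_apply, smul_apply, sub_apply,
      hge, one_apply_eq_self, x, add_sub_cancel_left, smul_smul]
    exact Submodule.smul_mem _ _ (Submodule.mem_span_singleton_self w)
  obtain ⟨c, hc⟩ := Submodule.mem_span_singleton.1 hXe
  rcases eq_or_ne c 0 with rfl | hc0
  -- If X e = 0, multiplying by exp(-s X) on the right keeps the image of e but leaves a distance
  -- o(s) from 1, against the factor 2 of near-minimality.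
  · exfalso
    rw [zero_smul] at hc
    have hE : Tendsto (fun n => ((s ∘ ψ) n)⁻¹ • (exp ((s ∘ ψ) n • (-X)) - 1)) atTop (𝓝 (-X)) := by
      have h := (hasDerivAt_exp_smul_zero (-X)).tendsto_slope_zero
      have h2 : Tendsto (s ∘ ψ) atTop (𝓝[≠] 0) :=
        tendsto_nhdsWithin_iff.2 ⟨hs0', Eventually.of_forall fun n => (hspos n).ne'⟩
      simpa using! h.comp h2
    have hE1 := tendsto_of_tendsto_slope (Eventually.of_forall hspos) hs0' hE
    have h3 := ((hXlim.mul hE1).add hE).norm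
    rw [mul_one, add_neg_cancel, norm_zero] at h3
    obtain ⟨n, hn⟩ := (h3.eventually_lt_const (show (0 : ℝ) < 1 / 2 by norm_num)).exists
    have h4 := hmin (φ (ψ n)) (g (φ (ψ n)) * expUnit ((s ∘ ψ) n • (-X)))
      (mul_mem (hgG _) (expUnit_mem_coneAut (smul_mem_coneLie (hΩ.lie.neg_mem hXlie) _)))
      (by
        rw [units_mul_apply, val_expUnit, exp_apply_eq_self (by simp [← hc]), hge])
    set σ : ℝ := (s ∘ ψ) n with hσ
    have hσ0 : 0 < σ := hspos n
    set E : V →L[ℝ] V := exp (σ • (-X))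
    have h6 : ((fun n => (s n)⁻¹ • ((g (φ n)).val - 1)) ∘ ψ) n * E + σ⁻¹ • (E - 1) =
        σ⁻¹ • ((g (φ (ψ n)) * expUnit (σ • (-X)) : GLV V).val - 1) := by
      rw [Function.comp_apply, Units.val_mul, val_expUnit, smul_mul_assoc]
      change σ⁻¹ • (((g (φ (ψ n))).val - 1) * E) + σ⁻¹ • (E - 1) = _
      rw [← smul_add, sub_mul, one_mul]
      congr 1
      abel
    rw [h6, norm_smul, norm_inv, Real.norm_of_nonneg hσ0.le, inv_mul_lt_iff₀ hσ0] at hn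
    change σ ≤ _ at h4
    linarith
  · refine ⟨(c⁻¹ * (δ / 2 * ‖v‖⁻¹)⁻¹) • X, hΩ.lie.smul_mem _ hXlie, ?_⟩
    rw [smul_apply, ← hc, hwdef, smul_smul, smul_smul]
    convert one_smul ℝ v using 2
    field_simp

end IsSymmetricCone

end LieAlgebra

/-! ### Simultaneous diagonalisation for an explicit inner product -/

section JointEigenspaces

open Function Module.End

/-- The form is an explicit function so that the trace form can be used on a space already carrying
the operator norm. -/
theorem iSup_iInf_eigenspace_eq_top_of_isSymm {M : Type*} [AddCommGroup M] [Module ℝ M]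
    [FiniteDimensional ℝ M] (B : M → M → ℝ) (hadd : ∀ x y z, B (x + y) z = B x z + B y z)
    (hsmul : ∀ (c : ℝ) x y, B (c • x) y = c * B x y) (hsymm : ∀ x y, B x y = B y x)
    (hnonneg : ∀ x, 0 ≤ B x x) (hdef : ∀ x, B x x = 0 → x = 0) {ι : Type*}
    (T : ι → Module.End ℝ M) (hT : ∀ i x y, B (T i x) y = B x (T i y))
    (hc : Pairwise (Commute on T)) :
    ⨆ χ : ι → ℝ, ⨅ i, eigenspace (T i) (χ i) = ⊤ := by
  let core : InnerProductSpace.Core ℝ M :=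
    { inner := B
      conj_inner_symm := fun x y => hsymm y x
      re_inner_nonneg := hnonneg
      add_left := hadd
      smul_left := fun x y r => hsmul r x y
      definite := hdef }
  let _ : NormedAddCommGroup M := core.toNormedAddCommGroup
  let _ : InnerProductSpace ℝ M := .ofCore core.toCore
  exact LinearMap.IsSymmetric.iSup_iInf_eq_top_of_commute (T := T) hT hc

end JointEigenspaces

/-! ### The trace form tr(A* B) -/

section Trace

variable {V : Type*} [NormedAddCommGroup V] [InnerProductSpace ℝ V]

/-- The trace of continuous endomorphisms. -/
noncomputable def opTrace : (V →L[ℝ] V) →ₗ[ℝ] ℝ :=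
  LinearMap.trace ℝ V ∘ₗ ContinuousLinearMap.coeLM ℝ

theorem opTrace_mul_comm (A B : V →L[ℝ] V) : opTrace (A * B) = opTrace (B * A) :=
  LinearMap.trace_mul_comm ℝ (A : V →ₗ[ℝ] V) (B : V →ₗ[ℝ] V)

theorem opTrace_conj (g : GLV V) (A : V →L[ℝ] V) :
    opTrace ((g : V →L[ℝ] V) * A * ((g⁻¹ : GLV V) : V →L[ℝ] V)) = opTrace A := by
  rw [opTrace_mul_comm, ← mul_assoc, Units.inv_mul, one_mul]

variable [FiniteDimensional ℝ V]

variable [CompleteSpace V]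

theorem opTrace_star_mul (A B : V →L[ℝ] V) :
    opTrace (star A * B) = ∑ i, inner ℝ (A (stdOrthonormalBasis ℝ V i))
      (B (stdOrthonormalBasis ℝ V i)) := by
  refine (LinearMap.trace_eq_sum_inner _ (stdOrthonormalBasis ℝ V)).trans
    (Finset.sum_congr rfl fun i _ => ?_)
  exact ContinuousLinearMap.adjoint_inner_right A _ _

theorem continuous_opTrace : Continuous (opTrace : (V →L[ℝ] V) → ℝ) := by
  have h : (opTrace : (V →L[ℝ] V) → ℝ) = fun T => ∑ i, inner ℝ (stdOrthonormalBasis ℝ V i)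
      (T (stdOrthonormalBasis ℝ V i)) := by
    ext1 T
    have := opTrace_star_mul 1 T
    rwa [star_one, one_mul] at this
  rw [h]
  fun_prop

theorem opTrace_star_mul_comm (A B : V →L[ℝ] V) :
    opTrace (star A * B) = opTrace (star B * A) := by
  simp only [opTrace_star_mul]
  exact Finset.sum_congr rfl fun i _ => real_inner_comm _ _

theorem opTrace_star (A : V →L[ℝ] V) : opTrace (star A) = opTrace A := by
  have := opTrace_star_mul_comm A 1
  simpa using this

theorem opTrace_star_mul_self_nonneg (A : V →L[ℝ] V) : 0 ≤ opTrace (star A * A) := by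
  rw [opTrace_star_mul]
  exact Finset.sum_nonneg fun i _ => real_inner_self_nonneg

theorem eq_zero_of_opTrace_star_mul_self {A : V →L[ℝ] V} (h : opTrace (star A * A) = 0) :
    A = 0 := by
  rw [opTrace_star_mul, Finset.sum_eq_zero_iff_of_nonneg fun i _ => real_inner_self_nonneg] at h
  ext1 x
  have : (A : V →ₗ[ℝ] V) = 0 := (stdOrthonormalBasis ℝ V).toBasis.ext fun i => by
    simpa using h i (Finset.mem_univ i)
  exact congrArg (fun f : V →ₗ[ℝ] V => f x) this

end Trace

/-! ### Root spaces and the infinitesimal action of 𝔞 + 𝔫 -/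

section RootSpaces

open NormedSpace Module.End

variable {V : Type*} [NormedAddCommGroup V] [InnerProductSpace ℝ V] [FiniteDimensional ℝ V]
  [CompleteSpace V] {Ω : Set V} {𝔞 : Submodule ℝ (V →L[ℝ] V)} {Z : 𝔞}

omit [FiniteDimensional ℝ V] in
theorem IsMaximalAbelianInP.mem_lie (h𝔞 : IsMaximalAbelianInP Ω 𝔞) (hΩ : IsSymmetricCone Ω)
    {X : V →L[ℝ] V} (hX : X ∈ 𝔞) : X ∈ hΩ.lie :=
  (Maximal.prop h𝔞 |>.1 X hX).1

omit [FiniteDimensional ℝ V] in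
theorem IsMaximalAbelianInP.star_eq (h𝔞 : IsMaximalAbelianInP Ω 𝔞) {X : V →L[ℝ] V}
    (hX : X ∈ 𝔞) : star X = X :=
  (Maximal.prop h𝔞 |>.1 X hX).2

omit [FiniteDimensional ℝ V] in
theorem IsMaximalAbelianInP.bracket_eq_zero (h𝔞 : IsMaximalAbelianInP Ω 𝔞) {X Y : V →L[ℝ] V}
    (hX : X ∈ 𝔞) (hY : Y ∈ 𝔞) : ⁅X, Y⁆ = 0 :=
  Maximal.prop h𝔞 |>.2 X hX Y hY

theorem star_mem_rootVectors (hΩ : IsSymmetricCone Ω) (h𝔞 : IsMaximalAbelianInP Ω 𝔞)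
    {α : Module.Dual ℝ 𝔞} {X : V →L[ℝ] V} (hX : X ∈ rootVectors Ω 𝔞 α) :
    star X ∈ rootVectors Ω 𝔞 (-α) := by
  refine ⟨hΩ.star_mem_lie hX.1, fun Y => ?_⟩
  have hY : star (Y : V →L[ℝ] V) = Y := h𝔞.star_eq Y.2
  have h := congrArg star (hX.2 Y)
  rw [Ring.lie_def, star_sub, star_mul, star_mul, hY, star_smul, star_trivial (α Y)] at h
  rw [Ring.lie_def, LinearMap.neg_apply, neg_smul, ← h, neg_sub]

omit [FiniteDimensional ℝ V] in
theorem star_eq_neg_of_exp_mem_orthGroup {S : V →L[ℝ] V}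
    (h : ∀ t : ℝ, expUnit (t • S) ∈ orthGroup V) : star S = -S := by
  have h1 := hasDerivAt_exp_smul_mul_exp_smul (star S) S
  have h2 : (fun t : ℝ => exp (t • star S) * exp (t • S)) = fun _ => 1 := by
    ext1 t
    have := congrArg Units.val (mem_orthGroup_iff.1 (h t))
    rwa [star_expUnit, star_smul, star_trivial t] at this
  rw [h2] at h1
  exact eq_neg_of_add_eq_zero_left (h1.unique (hasDerivAt_const _ _))

omit [FiniteDimensional ℝ V] in
theorem expUnit_mem_orthGroup {S : V →L[ℝ] V} (h : star S = -S) : expUnit S ∈ orthGroup V := by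
  rw [mem_orthGroup_iff, star_expUnit, h, ← inv_expUnit, inv_mul_cancel]

theorem apply_eq_zero_of_star_eq_neg (hΩ : IsSymmetricCone Ω) {e : V}
    (hfix : ∀ g ∈ coneAut Ω, g ∈ orthGroup V → (g : V →L[ℝ] V) e = e) {S : V →L[ℝ] V}
    (hS : S ∈ hΩ.lie) (h : star S = -S) : S e = 0 := by
  have h1 := (hasDerivAt_exp_smul_zero S).clm_apply (hasDerivAt_const (0 : ℝ) e)
  have h2 : (fun t : ℝ => exp (t • S) e) = fun _ => e := by
    ext1 t
    refine hfix (expUnit (t • S)) (mem_coneLie_iff.1 hS t) (expUnit_mem_orthGroup ?_)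
    rw [star_smul, star_trivial t, h, smul_neg]
  rw [h2] at h1
  simpa using h1.unique (hasDerivAt_const _ _)

theorem star_eq_neg_of_apply_eq_zero {e : V}
    (hstab : ∀ g ∈ coneAut Ω, (g : V →L[ℝ] V) e = e → g ∈ orthGroup V) {S : V →L[ℝ] V}
    (hS : S ∈ coneLie Ω) (h : S e = 0) : star S = -S :=
  star_eq_neg_of_exp_mem_orthGroup fun t => hstab _ (mem_coneLie_iff.1 hS t)
    (exp_apply_eq_self (by simp [h]))

/-- Maximality of 𝔞 against 𝔞 + ℝP. -/
theorem mem_of_commute_of_isMaximalAbelianInP (h𝔞 : IsMaximalAbelianInP Ω 𝔞)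
    (hΩ : IsSymmetricCone Ω) {P : V →L[ℝ] V} (hP : P ∈ hΩ.lie) (hsa : star P = P)
    (hcomm : ∀ Y ∈ 𝔞, Y * P = P * Y) : P ∈ 𝔞 := by
  have hlie : ∀ X ∈ 𝔞, ∀ Y ∈ 𝔞, X * Y = Y * X := fun X hX Y hY =>
    sub_eq_zero.1 (h𝔞.bracket_eq_zero hX hY)
  have hle : 𝔞 ⊔ Submodule.span ℝ {P} ≤ 𝔞 := by
    refine h𝔞.le_of_ge ⟨fun X hX => ?_, fun X hX Y hY => ?_⟩ le_sup_left
    · obtain ⟨A, hA, B, hB, rfl⟩ := Submodule.mem_sup.1 hX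
      obtain ⟨c, rfl⟩ := Submodule.mem_span_singleton.1 hB
      refine ⟨hΩ.lie.add_mem (h𝔞.mem_lie hΩ hA) (hΩ.lie.smul_mem c hP), ?_⟩
      change star _ = _
      rw [star_add, star_smul, star_trivial c, hsa, h𝔞.star_eq hA]
    · obtain ⟨A, hA, B, hB, rfl⟩ := Submodule.mem_sup.1 hX
      obtain ⟨c, rfl⟩ := Submodule.mem_span_singleton.1 hB
      obtain ⟨A', hA', B', hB', rfl⟩ := Submodule.mem_sup.1 hY
      obtain ⟨c', rfl⟩ := Submodule.mem_span_singleton.1 hB'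
      rw [Ring.lie_def, sub_eq_zero]
      simp only [add_mul, mul_add, smul_mul_assoc, mul_smul_comm, hlie A hA A' hA',
        hcomm A hA, hcomm A' hA', smul_add]
      rw [smul_comm c' c]
      abel
  exact hle (Submodule.mem_sup_right (Submodule.mem_span_singleton_self P))

/-- Evaluation at a vector as a linear map on continuous endomorphisms. -/
def evalLin (e : V) : (V →L[ℝ] V) →ₗ[ℝ] V where
  toFun X := X e
  map_add' _ _ := rfl
  map_smul' _ _ := rfl

/-- X - X* is skew, so it kills e and X e = X* e. For a negative root, replace X by X*, which has
the opposite root. For α = 0, replace X by its self-adjoint part, which commutes with 𝔞 and so lies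
in it. -/
theorem apply_mem_map_of_mem_rootVectors (hΩ : IsSymmetricCone Ω)
    (h𝔞 : IsMaximalAbelianInP Ω 𝔞) (hZ : IsRegularElement Ω 𝔞 Z) {e : V}
    (hfix : ∀ g ∈ coneAut Ω, g ∈ orthGroup V → (g : V →L[ℝ] V) e = e) {α : Module.Dual ℝ 𝔞}
    {X : V →L[ℝ] V} (hX : X ∈ rootVectors Ω 𝔞 α) :
    X e ∈ (𝔞 ⊔ nilLie Ω 𝔞 Z).map (evalLin e) := by
  have hskew : ∀ X ∈ hΩ.lie, X e = (star X) e := fun X hX => by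
    have := apply_eq_zero_of_star_eq_neg hΩ hfix
      (hΩ.lie.sub_mem hX (hΩ.star_mem_lie hX)) (by rw [star_sub, star_star, neg_sub])
    exact sub_eq_zero.1 this
  rcases eq_or_ne X 0 with rfl | hX0
  · simp
  rcases eq_or_ne α 0 with rfl | hα
  · have hP : (1 / 2 : ℝ) • (X + star X) ∈ 𝔞 := by
      refine mem_of_commute_of_isMaximalAbelianInP h𝔞 hΩ
        (hΩ.lie.smul_mem _ (hΩ.lie.add_mem hX.1 (hΩ.star_mem_lie hX.1))) ?_ fun Y hY => ?_
      · rw [star_smul, star_trivial (1 / 2 : ℝ), star_add, star_star, add_comm]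
      · have h1 := hX.2 ⟨Y, hY⟩
        have h2 := (star_mem_rootVectors hΩ h𝔞 hX).2 ⟨Y, hY⟩
        simp only [LinearMap.zero_apply, zero_smul, neg_zero, Ring.lie_def, sub_eq_zero] at h1 h2
        rw [mul_smul_comm, smul_mul_assoc, mul_add, add_mul, h1, h2]
    refine ⟨_, Submodule.mem_sup_left hP, ?_⟩
    change (1 / 2 : ℝ) • (X e + (star X) e) = X e
    rw [← hskew X hX.1, ← two_smul ℝ, smul_smul]
    norm_num
  · have hroot : IsRestrictedRoot Ω 𝔞 α := ⟨hα, X, hX, hX0⟩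
    rcases lt_or_gt_of_ne (hZ α hroot) with h | h
    · have hs := star_mem_rootVectors hΩ h𝔞 hX
      rw [hskew X hX.1]
      refine ⟨star X, Submodule.mem_sup_right (Submodule.subset_span ⟨-α, ⟨neg_ne_zero.2 hα, _, hs,
        fun h0 => hX0 (star_eq_zero.1 h0)⟩, by simpa using h, hs⟩), rfl⟩
    · exact ⟨X, Submodule.mem_sup_right (Submodule.subset_span ⟨α, hroot, h, hX⟩), rfl⟩

/-- The adjoint action of an element of the Lie algebra. -/
def adLie (hΩ : IsSymmetricCone Ω) (Y : V →L[ℝ] V) (hY : Y ∈ hΩ.lie) : Module.End ℝ hΩ.lie where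
  toFun X := ⟨⁅Y, (X : V →L[ℝ] V)⁆, hΩ.bracket_mem_lie hY X.2⟩
  map_add' _ _ := Subtype.ext (by simp [Ring.lie_def, mul_add, add_mul]; abel)
  map_smul' c X := Subtype.ext (by simp [Ring.lie_def, smul_sub])

theorem coe_adLie_apply (hΩ : IsSymmetricCone Ω) (Y : V →L[ℝ] V) (hY : Y ∈ hΩ.lie)
    (X : hΩ.lie) : (adLie hΩ Y hY X : V →L[ℝ] V) = ⁅Y, (X : V →L[ℝ] V)⁆ := rfl

/-- Self-adjointness of Y ∈ 𝔞 makes ad Y symmetric for tr(X* W), and 𝔞 is abelian. -/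
theorem iSup_iInf_eigenspace_adLie (hΩ : IsSymmetricCone Ω) (h𝔞 : IsMaximalAbelianInP Ω 𝔞) :
    ⨆ χ : 𝔞 → ℝ, ⨅ Y : 𝔞, eigenspace (adLie hΩ Y (h𝔞.mem_lie hΩ Y.2)) (χ Y) = ⊤ := by
  have hsymm : ∀ (Y : 𝔞) (X W : hΩ.lie),
      opTrace (star (adLie hΩ Y (h𝔞.mem_lie hΩ Y.2) X : V →L[ℝ] V) * (W : V →L[ℝ] V)) =
        opTrace (star (X : V →L[ℝ] V) *
          (adLie hΩ Y (h𝔞.mem_lie hΩ Y.2) W : V →L[ℝ] V)) := by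
    intro Y X W
    have hY : star (Y : V →L[ℝ] V) = Y := h𝔞.star_eq Y.2
    rw [coe_adLie_apply, coe_adLie_apply, Ring.lie_def, Ring.lie_def, star_sub, star_mul,
      star_mul, hY, sub_mul, mul_sub, map_sub, map_sub, mul_assoc,
      ← mul_assoc (star (X : V →L[ℝ] V)) _ (Y : V →L[ℝ] V),
      opTrace_mul_comm _ (Y : V →L[ℝ] V), mul_assoc]
  have hcomm : Pairwise (Function.onFun Commute fun Y : 𝔞 =>
      adLie hΩ Y (h𝔞.mem_lie hΩ Y.2)) := by
    intro Y Y' _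
    have h : (Y : V →L[ℝ] V) * Y' = Y' * Y := sub_eq_zero.1 (h𝔞.bracket_eq_zero Y.2 Y'.2)
    refine LinearMap.ext fun X => Subtype.ext ?_
    change ⁅(Y : V →L[ℝ] V), ⁅(Y' : V →L[ℝ] V), (X : V →L[ℝ] V)⁆⁆ =
      ⁅(Y' : V →L[ℝ] V), ⁅(Y : V →L[ℝ] V), (X : V →L[ℝ] V)⁆⁆
    simp only [Ring.lie_def, mul_sub, sub_mul]
    rw [← mul_assoc, ← mul_assoc (Y' : V →L[ℝ] V) (Y : V →L[ℝ] V), h,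
      mul_assoc (X : V →L[ℝ] V), mul_assoc (X : V →L[ℝ] V), h]
    simp only [mul_assoc]
    abel
  exact iSup_iInf_eigenspace_eq_top_of_isSymm (M := hΩ.lie)
    (fun X Y => opTrace (star (X : V →L[ℝ] V) * (Y : V →L[ℝ] V)))
    (fun X Y W => by rw [Submodule.coe_add, star_add, add_mul, map_add])
    (fun c X Y => by
      rw [Submodule.coe_smul, star_smul, star_trivial c, smul_mul_assoc, map_smul, smul_eq_mul])
    (fun X Y => opTrace_star_mul_comm _ _) (fun X => opTrace_star_mul_self_nonneg _)
    (fun X h => Subtype.ext (eq_zero_of_opTrace_star_mul_self h)) _ hsymm hcomm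

theorem map_evalLin_sup_eq_top (hΩ : IsSymmetricCone Ω) (h𝔞 : IsMaximalAbelianInP Ω 𝔞)
    (hZ : IsRegularElement Ω 𝔞 Z) {e : V} (he : e ∈ Ω)
    (hfix : ∀ g ∈ coneAut Ω, g ∈ orthGroup V → (g : V →L[ℝ] V) e = e) :
    (𝔞 ⊔ nilLie Ω 𝔞 Z).map (evalLin e) = ⊤ := by
  set p := (𝔞 ⊔ nilLie Ω 𝔞 Z).map (evalLin e)
  have hle : (⊤ : Submodule ℝ hΩ.lie) ≤ p.comap (evalLin e ∘ₗ hΩ.lie.subtype) := by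
    rw [← iSup_iInf_eigenspace_adLie hΩ h𝔞]
    refine iSup_le fun χ X hX => ?_
    have hX' : ∀ Y : 𝔞, ⁅(Y : V →L[ℝ] V), (X : V →L[ℝ] V)⁆ = χ Y • (X : V →L[ℝ] V) := by
      intro Y
      have := (Submodule.mem_iInf _).1 hX Y
      rw [mem_eigenspace_iff] at this
      exact congrArg Subtype.val this
    change (X : V →L[ℝ] V) e ∈ p
    rcases eq_or_ne (X : V →L[ℝ] V) 0 with h0 | h0
    · rw [h0]; exact p.zero_mem
    let α : Module.Dual ℝ 𝔞 :=
      { toFun := χ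
        map_add' := fun Y Y' => by
          refine smul_left_injective ℝ h0 ?_
          simp only [add_smul]
          rw [← hX', ← hX', ← hX', Submodule.coe_add]
          simp only [Ring.lie_def, add_mul, mul_add]
          abel
        map_smul' := fun c Y => by
          refine smul_left_injective ℝ h0 ?_
          simp only [RingHom.id_apply, smul_eq_mul, mul_smul]
          rw [← hX', ← hX', Submodule.coe_smul]
          simp [Ring.lie_def, smul_sub] }
    exact apply_mem_map_of_mem_rootVectors hΩ h𝔞 hZ hfix (α := α) ⟨X.2, hX'⟩
  refine eq_top_iff.2 fun v _ => ?_
  obtain ⟨X, hX, rfl⟩ := hΩ.exists_mem_lie_apply_eq he v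
  exact hle (x := ⟨X, hX⟩) trivial

omit [FiniteDimensional ℝ V] [CompleteSpace V] in
-- The product AB has weight a + b under ad Y, and commutators are traceless.
theorem opTrace_mul_eq_zero_of_bracket {Y A B : V →L[ℝ] V} {a b : ℝ} (hA : ⁅Y, A⁆ = a • A)
    (hB : ⁅Y, B⁆ = b • B) (hab : a + b ≠ 0) : opTrace (A * B) = 0 := by
  have h : (a + b) • (A * B) = Y * (A * B) - A * B * Y := by
    rw [add_smul, ← smul_mul_assoc, ← mul_smul_comm, ← hA, ← hB, Ring.lie_def, Ring.lie_def]
    noncomm_ring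
  have h2 := congrArg opTrace h
  rw [map_smul, map_sub, opTrace_mul_comm Y, sub_self, smul_eq_mul] at h2
  exact (mul_eq_zero.1 h2).resolve_left hab

theorem opTrace_mul_nilLie (h𝔞 : IsMaximalAbelianInP Ω 𝔞) {X Y : V →L[ℝ] V} (hX : X ∈ 𝔞)
    (hY : Y ∈ nilLie Ω 𝔞 Z) : opTrace (X * Y) = 0 := by
  induction hY using Submodule.span_induction with
  | mem Y hY =>
    obtain ⟨α, -, hpos, hY⟩ := hY
    exact opTrace_mul_eq_zero_of_bracket (a := 0) (by rw [h𝔞.bracket_eq_zero Z.2 hX, zero_smul])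
      (hY.2 Z) (by linarith)
  | zero => simp
  | add Y Y' _ _ h h' => rw [mul_add, map_add, h, h', add_zero]
  | smul c Y _ h => rw [mul_smul_comm, map_smul, h, smul_zero]

theorem opTrace_nilLie_mul_nilLie {X Y : V →L[ℝ] V} (hX : X ∈ nilLie Ω 𝔞 Z)
    (hY : Y ∈ nilLie Ω 𝔞 Z) : opTrace (X * Y) = 0 := by
  induction hY using Submodule.span_induction with
  | mem Y hY =>
    obtain ⟨α, -, hpos, hY⟩ := hY
    induction hX using Submodule.span_induction with
    | mem X hX =>
      obtain ⟨β, -, hpos', hX⟩ := hX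
      exact opTrace_mul_eq_zero_of_bracket (hX.2 Z) (hY.2 Z) (by linarith)
    | zero => simp
    | add X X' _ _ h h' => rw [add_mul, map_add, h, h', add_zero]
    | smul c X _ h => rw [smul_mul_assoc, map_smul, h, smul_zero]
  | zero => simp
  | add Y Y' _ _ h h' => rw [mul_add, map_add, h, h', add_zero]
  | smul c Y _ h => rw [mul_smul_comm, map_smul, h, smul_zero]

omit [FiniteDimensional ℝ V] in
theorem nilLie_le_lie (hΩ : IsSymmetricCone Ω) : nilLie Ω 𝔞 Z ≤ hΩ.lie :=
  Submodule.span_le.2 fun _ ⟨_, _, _, hX⟩ => hX.1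

/-- Move x to e by conjugation: S = g⁻¹(X + Y)g kills e, so it is skew and tr S² = -tr(S* S) ≤ 0.
But tr S² = tr (X + Y)² = tr X² ≥ 0, the other terms vanishing by weights. Hence S and X are zero,
and then Y. -/
theorem eq_zero_of_apply_add_apply_eq_zero (hΩ : IsSymmetricCone Ω)
    (h𝔞 : IsMaximalAbelianInP Ω 𝔞) {e : V} (he : e ∈ Ω)
    (hstab : ∀ g ∈ coneAut Ω, (g : V →L[ℝ] V) e = e → g ∈ orthGroup V)
    {x : V} (hx : x ∈ Ω) {X Y : V →L[ℝ] V} (hX : X ∈ 𝔞) (hY : Y ∈ nilLie Ω 𝔞 Z)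
    (h : X x + Y x = 0) : X = 0 ∧ Y = 0 := by
  obtain ⟨g, hg, rfl⟩ := hΩ.transitive e he x hx
  set S : V →L[ℝ] V := ((g⁻¹ : GLV V) : V →L[ℝ] V) * (X + Y) * (g : V →L[ℝ] V) with hSdef
  have hXs : star X = X := h𝔞.star_eq hX
  have hS : S ∈ coneLie Ω := by
    have := conj_mem_coneLie (hΩ.lie.add_mem (h𝔞.mem_lie hΩ hX) (nilLie_le_lie hΩ hY)) (inv_mem hg)
    rwa [inv_inv] at this
  have hSe : S e = 0 := by
    change ((g⁻¹ : GLV V) : V →L[ℝ] V) ((X + Y) ((g : V →L[ℝ] V) e)) = 0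
    rw [add_apply, h, map_zero]
  have hskew := star_eq_neg_of_apply_eq_zero hstab hS hSe
  have h1 : opTrace (S * S) = opTrace (star X * X) := by
    have hSS : S * S = ((g⁻¹ : GLV V) : V →L[ℝ] V) * ((X + Y) * (X + Y)) *
        ((g⁻¹⁻¹ : GLV V) : V →L[ℝ] V) := by
      rw [inv_inv, hSdef]
      simp only [mul_assoc]
      rw [Units.mul_inv_cancel_left]
    rw [hSS, opTrace_conj, hXs, add_mul, mul_add, mul_add]
    simp only [map_add]
    rw [opTrace_mul_comm Y X, opTrace_mul_nilLie h𝔞 hX hY, opTrace_nilLie_mul_nilLie hY hY]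
    ring
  have h2 : opTrace (S * S) = -opTrace (star S * S) := by
    rw [hskew, neg_mul, map_neg, neg_neg]
  have h3 := opTrace_star_mul_self_nonneg X
  have h4 := opTrace_star_mul_self_nonneg S
  have hX0 : X = 0 := eq_zero_of_opTrace_star_mul_self (by linarith)
  have hS0 : S = 0 := eq_zero_of_opTrace_star_mul_self (by linarith)
  refine ⟨hX0, ?_⟩
  have h5 : X + Y = (g : V →L[ℝ] V) * S * ((g⁻¹ : GLV V) : V →L[ℝ] V) := by
    rw [hSdef]
    simp only [mul_assoc]
    rw [Units.mul_inv, mul_one, Units.mul_inv_cancel_left]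
  rwa [hS0, mul_zero, zero_mul, hX0, zero_add] at h5

end RootSpaces

/-! ### The group 𝒜𝒩 and freeness of its action at the base point -/

section IwasawaSubgroup

open Filter Topology NormedSpace

variable {V : Type*} [NormedAddCommGroup V] [InnerProductSpace ℝ V]
  [FiniteDimensional ℝ V] [CompleteSpace V] {Ω : Set V} {𝔞 : Submodule ℝ (V →L[ℝ] V)} {Z : 𝔞}

omit [FiniteDimensional ℝ V] in
theorem expSubgroup_le {𝔟 : Submodule ℝ (V →L[ℝ] V)} {K : Subgroup (GLV V)}
    (h : ∀ X ∈ 𝔟, expUnit X ∈ K) : expSubgroup 𝔟 ≤ K := by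
  refine (Subgroup.closure_le _).2 ?_
  rintro g ⟨X, hX, hg⟩
  have : g = expUnit X := Units.ext hg
  rw [this]
  exact h X hX

omit [FiniteDimensional ℝ V] in
theorem expUnit_mem_expSubgroup {𝔟 : Submodule ℝ (V →L[ℝ] V)} {X : V →L[ℝ] V} (hX : X ∈ 𝔟) :
    expUnit X ∈ expSubgroup 𝔟 :=
  Subgroup.subset_closure ⟨X, hX, rfl⟩

theorem iwasawaAN_le {K : Subgroup (GLV V)} (h₁ : ∀ X ∈ 𝔞, expUnit X ∈ K)
    (h₂ : ∀ X ∈ nilLie Ω 𝔞 Z, expUnit X ∈ K) : iwasawaAN Ω 𝔞 Z ≤ K :=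
  sup_le (expSubgroup_le h₁) (expSubgroup_le h₂)

theorem expUnit_mul_expUnit_mem_iwasawaAN {X Y : V →L[ℝ] V} (hX : X ∈ 𝔞)
    (hY : Y ∈ nilLie Ω 𝔞 Z) : expUnit X * expUnit Y ∈ iwasawaAN Ω 𝔞 Z :=
  mul_mem (Subgroup.mem_sup_left (expUnit_mem_expSubgroup hX))
    (Subgroup.mem_sup_right (expUnit_mem_expSubgroup hY))

omit [FiniteDimensional ℝ V] [CompleteSpace V] in
theorem coneAutZero_le : coneAutZero Ω ≤ coneAut Ω := Subgroup.map_subtype_le _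

omit [FiniteDimensional ℝ V] in
theorem expUnit_mem_coneAutZero {X : V →L[ℝ] V} (hX : X ∈ coneLie Ω) :
    expUnit X ∈ coneAutZero Ω := by
  let γ : ℝ → coneAut Ω := fun t => ⟨expUnit (t • X), mem_coneLie_iff.1 hX t⟩
  have hγ : Continuous γ :=
    (continuous_expUnit.comp (by fun_prop : Continuous fun t : ℝ => t • X)).subtype_mk _
  have h1 : Set.range γ ⊆ connectedComponent (1 : coneAut Ω) :=
    (isPreconnected_range hγ).subset_connectedComponent ⟨0, Subtype.ext (by simp [γ])⟩
  exact ⟨γ 1, h1 ⟨1, rfl⟩, by simp [γ]⟩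

/-- The contragredient `g ↦ (g*)⁻¹` as an endomorphism of `GL(V)`. -/
noncomputable def invStarHom (V : Type*) [NormedAddCommGroup V] [InnerProductSpace ℝ V]
    [CompleteSpace V] : GLV V →* GLV V where
  toFun g := (star g)⁻¹
  map_one' := by simp
  map_mul' := inv_star_mul

theorem iwasawaAN_le_of_lie (hΩ : IsSymmetricCone Ω) (h𝔞 : IsMaximalAbelianInP Ω 𝔞)
    {K : Subgroup (GLV V)} (h : ∀ X ∈ hΩ.lie, expUnit X ∈ K) : iwasawaAN Ω 𝔞 Z ≤ K :=
  iwasawaAN_le (fun _ hX => h _ (h𝔞.mem_lie hΩ hX)) fun _ hX => h _ (nilLie_le_lie hΩ hX)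

theorem iwasawaAN_le_coneAutZero (hΩ : IsSymmetricCone Ω) (h𝔞 : IsMaximalAbelianInP Ω 𝔞) :
    iwasawaAN Ω 𝔞 Z ≤ coneAutZero Ω :=
  iwasawaAN_le_of_lie hΩ h𝔞 fun _ => expUnit_mem_coneAutZero

theorem inv_star_mem_coneAutZero (hΩ : IsSymmetricCone Ω) (h𝔞 : IsMaximalAbelianInP Ω 𝔞)
    {h : GLV V} (hh : h ∈ iwasawaAN Ω 𝔞 Z) : (star h)⁻¹ ∈ coneAutZero Ω := by
  have : iwasawaAN Ω 𝔞 Z ≤ (coneAutZero Ω).comap (invStarHom V) := by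
    refine iwasawaAN_le_of_lie hΩ h𝔞 fun X hX => ?_
    change (star (expUnit X))⁻¹ ∈ coneAutZero Ω
    rw [star_expUnit, inv_expUnit]
    exact expUnit_mem_coneAutZero (hΩ.lie.neg_mem (hΩ.star_mem_lie hX))
  exact this hh

omit [FiniteDimensional ℝ V] in
-- The conjugate multiplied by exp(ta) has zero derivative in t.
theorem exp_neg_mul_mul_exp_of_bracket {T Y : V →L[ℝ] V} {a : ℝ} (h : ⁅T, Y⁆ = a • Y) (t : ℝ) :
    exp (-(t • T)) * Y * exp (t • T) = Real.exp (-(t * a)) • Y := by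
  set f : ℝ → V →L[ℝ] V := fun t => Real.exp (t * a) • (exp (-(t • T)) * Y * exp (t • T)) with hf
  have hd : ∀ t, HasDerivAt f 0 t := by
    intro t
    have h1 : HasDerivAt (fun t : ℝ => exp (t • T)) (T * exp (t • T)) t :=
      hasDerivAt_exp_smul_const' T t
    have h2 : HasDerivAt (fun t : ℝ => exp (-(t • T))) (exp (-(t • T)) * (-T)) t := by
      simpa using hasDerivAt_exp_smul_const (𝕂 := ℝ) (-T) t
    have h3 : HasDerivAt (fun t : ℝ => Real.exp (t * a)) (Real.exp (t * a) * a) t := by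
      simpa using ((hasDerivAt_id t).mul_const a).exp
    have h4 := h3.smul ((h2.mul_const Y).mul h1)
    convert! h4 using 1
    have h5 : T * Y = a • Y + Y * T := by rw [← h, Ring.lie_def, sub_add_cancel]
    have h6 : exp (-(t • T)) * -T * Y * exp (t • T) + exp (-(t • T)) * Y * (T * exp (t • T)) =
        -(a • (exp (-(t • T)) * Y * exp (t • T))) := by
      calc _ = exp (-(t • T)) * (-(T * Y) + Y * T) * exp (t • T) := by noncomm_ring
        _ = exp (-(t • T)) * (-(a • Y)) * exp (t • T) := by rw [h5]; congr 2; abel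
        _ = _ := by rw [mul_neg, neg_mul, mul_smul_comm, smul_mul_assoc]
    rw [h6, smul_neg, smul_smul]
    simp
  have hc := is_const_of_deriv_eq_zero (fun t => (hd t).differentiableAt) (fun t => (hd t).deriv) t 0
  simp only [hf, zero_mul, Real.exp_zero, zero_smul, neg_zero, exp_zero, one_mul, mul_one,
    one_smul] at hc
  rw [Real.exp_neg, ← hc, smul_smul, hc, inv_mul_cancel₀ (Real.exp_pos _).ne', one_smul]

theorem tendsto_conj_nilLie {Y : V →L[ℝ] V} (hY : Y ∈ nilLie Ω 𝔞 Z) :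
    Tendsto (fun t : ℝ => exp (-(t • (Z : V →L[ℝ] V))) * Y * exp (t • (Z : V →L[ℝ] V))) atTop
      (𝓝 0) := by
  induction hY using Submodule.span_induction with
  | mem Y hY =>
    obtain ⟨α, -, hpos, hY⟩ := hY
    simp only [exp_neg_mul_mul_exp_of_bracket (hY.2 Z)]
    have h1 : Tendsto (fun t : ℝ => Real.exp (-(t * α Z))) atTop (𝓝 0) :=
      Real.tendsto_exp_neg_atTop_nhds_zero.comp (tendsto_id.atTop_mul_const hpos)
    simpa using h1.smul_const Y
  | zero => simp
  | add Y Y' _ _ h h' => simpa [mul_add, add_mul] using h.add h'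
  | smul c Y _ h => simpa using h.const_smul c

omit [FiniteDimensional ℝ V] in
theorem tendsto_conj_inv {T X : V →L[ℝ] V} {g : GLV V}
    (hg : Tendsto (fun t : ℝ => exp (-(t • T)) * (g : V →L[ℝ] V) * exp (t • T)) atTop
      (𝓝 (exp X))) :
    Tendsto (fun t : ℝ => exp (-(t • T)) * ((g⁻¹ : GLV V) : V →L[ℝ] V) * exp (t • T)) atTop
      (𝓝 (exp (-X))) := by
  have h1 := (NormedRing.inverse_continuousAt (expUnit X)).tendsto.comp hg
  rw [Ring.inverse_unit, val_inv_expUnit] at h1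
  refine h1.congr fun t => ?_
  have h2 : exp (-(t • T)) * (g : V →L[ℝ] V) * exp (t • T) =
      ((expUnit (-(t • T)) * g * expUnit (t • T) : GLV V) : V →L[ℝ] V) := rfl
  rw [Function.comp_apply, h2, Ring.inverse_unit, mul_inv_rev, mul_inv_rev, inv_expUnit,
    inv_expUnit, neg_neg, mul_assoc]
  rfl

/-- The elements of `GL(V)` whose conjugates by `exp (-t Z)` tend to an element of `exp 𝔞`. -/
def limitSubgroup (h𝔞 : IsMaximalAbelianInP Ω 𝔞) (Z : 𝔞) : Subgroup (GLV V) where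
  carrier := {h | ∃ X ∈ 𝔞, Tendsto
    (fun t : ℝ => exp (-(t • (Z : V →L[ℝ] V))) * (h : V →L[ℝ] V) * exp (t • (Z : V →L[ℝ] V))) atTop
    (𝓝 (exp X))}
  one_mem' := ⟨0, zero_mem _, by simp [exp_neg_mul_exp_real]⟩
  mul_mem' := by
    rintro g h ⟨X, hX, hg⟩ ⟨Y, hY, hh⟩
    refine ⟨X + Y, add_mem hX hY, ?_⟩
    rw [exp_add_of_commute_real (sub_eq_zero.1 (h𝔞.bracket_eq_zero hX hY))]
    refine (hg.mul hh).congr fun t => ?_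
    simp only [mul_assoc, Units.val_mul]
    rw [← mul_assoc (exp (t • (Z : V →L[ℝ] V))) (exp _), exp_mul_exp_neg_real, one_mul]
  inv_mem' := by
    rintro g ⟨X, hX, hg⟩
    exact ⟨-X, neg_mem hX, tendsto_conj_inv hg⟩

/-- It suffices to test generators: exp 𝔞 commutes with exp(tZ), while conjugation contracts 𝔫 to 0.
The limit plays the role of the 𝒜-component. -/
theorem iwasawaAN_le_limitSubgroup (h𝔞 : IsMaximalAbelianInP Ω 𝔞) :
    iwasawaAN Ω 𝔞 Z ≤ limitSubgroup h𝔞 Z := by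
  refine iwasawaAN_le (fun X hX => ⟨X, hX, ?_⟩) fun Y hY => ⟨0, zero_mem _, ?_⟩
  · refine tendsto_const_nhds.congr fun t => ?_
    have h1 : Commute (t • (Z : V →L[ℝ] V)) X :=
      Commute.smul_left (sub_eq_zero.1 (h𝔞.bracket_eq_zero Z.2 hX)) t
    rw [val_expUnit, mul_assoc, ← exp_add_of_commute_real h1.symm, add_comm,
      exp_add_of_commute_real h1, ← mul_assoc, exp_neg_mul_exp_real, one_mul]
  · refine (((continuous_exp_real (𝔸 := V →L[ℝ] V)).tendsto 0).comp
      (tendsto_conj_nilLie hY)).congr fun t => ?_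
    have := exp_units_conj_real (expUnit (-(t • (Z : V →L[ℝ] V)))) Y
    simpa using this

theorem opTrace_eq_of_tendsto {h X : V →L[ℝ] V} (hh : Tendsto
    (fun t : ℝ => exp (-(t • (Z : V →L[ℝ] V))) * h * exp (t • (Z : V →L[ℝ] V))) atTop (𝓝 (exp X))) :
    opTrace h = opTrace (exp X) := by
  have h1 := (continuous_opTrace.tendsto _).comp hh
  refine tendsto_nhds_unique (tendsto_const_nhds.congr fun t => ?_) h1
  have := opTrace_conj (expUnit (-(t • (Z : V →L[ℝ] V)))) h
  simpa using this.symm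

/-- For orthogonal k, the squared trace norm of k - 1 is 2 tr 1 - 2 tr k. -/
theorem eq_one_of_opTrace_le {k : GLV V} (hk : k ∈ orthGroup V)
    (h : opTrace (1 : V →L[ℝ] V) ≤ opTrace (k : V →L[ℝ] V)) : k = 1 := by
  have h1 : star (k : V →L[ℝ] V) * k = 1 := congrArg Units.val (mem_orthGroup_iff.1 hk)
  have h2 : opTrace (star ((k : V →L[ℝ] V) - 1) * ((k : V →L[ℝ] V) - 1)) =
      2 * opTrace (1 : V →L[ℝ] V) - 2 * opTrace (k : V →L[ℝ] V) := by
    rw [star_sub, star_one, sub_mul, mul_sub, h1, mul_one, one_mul, map_sub, map_sub, map_sub,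
      opTrace_star]
    ring
  have h3 := opTrace_star_mul_self_nonneg ((k : V →L[ℝ] V) - 1)
  have h4 := eq_zero_of_opTrace_star_mul_self
    (show opTrace (star ((k : V →L[ℝ] V) - 1) * ((k : V →L[ℝ] V) - 1)) = 0 by linarith)
  exact Units.ext (sub_eq_zero.1 h4)

/-- Expand the squared trace norm of exp(X/2) - exp(-X/2). -/
theorem two_mul_opTrace_one_le {X : V →L[ℝ] V} (hX : star X = X) :
    2 * opTrace (1 : V →L[ℝ] V) ≤ opTrace (exp X) + opTrace (exp (-X)) := by
  set Y : V →L[ℝ] V := (1 / 2 : ℝ) • X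
  have hY : star Y = Y := by rw [star_smul, star_trivial (1 / 2 : ℝ), hX]
  have hYY : Y + Y = X := by rw [← add_smul]; norm_num
  have hs : ∀ W : V →L[ℝ] V, star W = W → star (exp W) = exp W := fun W hW => by
    rw [star_exp, hW]
  have h1 := opTrace_star_mul_self_nonneg (exp Y - exp (-Y))
  rw [star_sub, hs Y hY, hs (-Y) (by rw [star_neg, hY]), sub_mul, mul_sub, mul_sub,
    exp_mul_exp_neg_real, exp_neg_mul_exp_real, ← exp_add_of_commute_real (Commute.refl Y),
    ← exp_add_of_commute_real (Commute.refl (-Y)), ← neg_add, hYY] at h1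
  simp only [map_sub] at h1
  linarith

/-- An h fixing e is orthogonal, so tr h = tr h⁻¹. Its conjugates tend to exp X with X ∈ 𝔞, so 2 tr
h = tr exp X + tr exp(-X) ≥ 2 tr 1, which forces h = 1. -/
theorem eq_one_of_mem_iwasawaAN_of_apply_eq (hΩ : IsSymmetricCone Ω)
    (h𝔞 : IsMaximalAbelianInP Ω 𝔞) {e : V}
    (hstab : ∀ g ∈ coneAut Ω, (g : V →L[ℝ] V) e = e → g ∈ orthGroup V)
    {h : GLV V} (hh : h ∈ iwasawaAN Ω 𝔞 Z) (hhe : (h : V →L[ℝ] V) e = e) : h = 1 := by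
  have ho : h ∈ orthGroup V := hstab h (coneAutZero_le (iwasawaAN_le_coneAutZero hΩ h𝔞 hh)) hhe
  obtain ⟨X, hX, hlim⟩ := iwasawaAN_le_limitSubgroup h𝔞 hh
  refine eq_one_of_opTrace_le ho ?_
  have h2 : opTrace ((h⁻¹ : GLV V) : V →L[ℝ] V) = opTrace (h : V →L[ℝ] V) := by
    have : h⁻¹ = star h := inv_eq_of_mul_eq_one_left (mem_orthGroup_iff.1 ho)
    rw [this, Units.coe_star, opTrace_star]
  have h3 : opTrace ((h⁻¹ : GLV V) : V →L[ℝ] V) = opTrace (exp (-X)) :=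
    opTrace_eq_of_tendsto (Z := Z) (tendsto_conj_inv hlim)
  have h4 := opTrace_eq_of_tendsto hlim
  have h5 := two_mul_opTrace_one_le (h𝔞.star_eq hX)
  linarith

end IwasawaSubgroup

/-! ### Local surjectivity of exp X exp Y after evaluation -/

section BanachAlgebra

open Filter Topology NormedSpace

variable {𝔸 F : Type*} [NormedRing 𝔸] [NormedAlgebra ℝ 𝔸] [CompleteSpace 𝔸]
  [NormedAddCommGroup F] [NormedSpace ℝ F] [CompleteSpace F]

/-- The strict derivative at 0 is (X, Y) ↦ ev X + ev Y, so a surjective infinitesimal action gives a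
map open at 0. -/
theorem map_exp_mul_exp_nhds_zero (𝔞 𝔫 : Submodule ℝ 𝔸) [CompleteSpace 𝔞] [CompleteSpace 𝔫]
    (ev : 𝔸 →L[ℝ] F) (hsurj : ∀ v, ∃ p : 𝔞 × 𝔫, ev p.1 + ev p.2 = v) :
    map (fun p : 𝔞 × 𝔫 => ev (exp (p.1 : 𝔸) * exp (p.2 : 𝔸))) (𝓝 0) = 𝓝 (ev 1) := by
  have h0 : HasStrictFDerivAt (exp : 𝔸 → 𝔸) (1 : 𝔸 →L[ℝ] 𝔸) 0 := hasStrictFDerivAt_exp_zero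
  have h1 : HasStrictFDerivAt (fun p : 𝔞 × 𝔫 => exp (p.1 : 𝔸))
      ((1 : 𝔸 →L[ℝ] 𝔸) ∘L (𝔞.subtypeL ∘L ContinuousLinearMap.fst ℝ 𝔞 𝔫)) 0 :=
    HasStrictFDerivAt.comp (f := 𝔞.subtypeL ∘L ContinuousLinearMap.fst ℝ 𝔞 𝔫) 0
      (by simpa using h0) (ContinuousLinearMap.hasStrictFDerivAt _)
  have h2 : HasStrictFDerivAt (fun p : 𝔞 × 𝔫 => exp (p.2 : 𝔸))
      ((1 : 𝔸 →L[ℝ] 𝔸) ∘L (𝔫.subtypeL ∘L ContinuousLinearMap.snd ℝ 𝔞 𝔫)) 0 :=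
    HasStrictFDerivAt.comp (f := 𝔫.subtypeL ∘L ContinuousLinearMap.snd ℝ 𝔞 𝔫) 0
      (by simpa using h0) (ContinuousLinearMap.hasStrictFDerivAt _)
  have h3 := ev.hasStrictFDerivAt.comp (0 : 𝔞 × 𝔫) (h1.mul' h2)
  have h4 := h3.map_nhds_eq_of_surj (LinearMap.range_eq_top.2 fun v => by
    obtain ⟨p, hp⟩ := hsurj v
    exact ⟨p, by simpa [add_comm] using hp⟩)
  simpa using! h4

end BanachAlgebra

/-! ### Simple transitivity of ℋ on the cone -/

section OrbitMap

open Filter Topology NormedSpace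

variable {V : Type*} [NormedAddCommGroup V] [InnerProductSpace ℝ V]
  [FiniteDimensional ℝ V] [CompleteSpace V] {Ω : Set V} {𝔞 : Submodule ℝ (V →L[ℝ] V)} {Z : 𝔞}

/-- The infinitesimal action `(X, Y) ↦ X x + Y x` of `𝔞 × 𝔫` at a point `x`. -/
def infAction (𝔞 𝔫 : Submodule ℝ (V →L[ℝ] V)) (x : V) : (𝔞 × 𝔫) →ₗ[ℝ] V :=
  evalLin x ∘ₗ 𝔞.subtype.coprod 𝔫.subtype

theorem infAction_surjective (hΩ : IsSymmetricCone Ω) (h𝔞 : IsMaximalAbelianInP Ω 𝔞)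
    (hZ : IsRegularElement Ω 𝔞 Z) {e : V} (he : e ∈ Ω)
    (hstab : ∀ g ∈ coneAut Ω, (g : V →L[ℝ] V) e = e → g ∈ orthGroup V)
    (hfix : ∀ g ∈ coneAut Ω, g ∈ orthGroup V → (g : V →L[ℝ] V) e = e) {x : V} (hx : x ∈ Ω) :
    Function.Surjective (infAction 𝔞 (nilLie Ω 𝔞 Z) x) := by
  have hinj : ∀ x ∈ Ω, Function.Injective (infAction 𝔞 (nilLie Ω 𝔞 Z) x) := by
    intro x hx
    refine (injective_iff_map_eq_zero _).2 fun p hp => ?_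
    obtain ⟨h1, h2⟩ := eq_zero_of_apply_add_apply_eq_zero hΩ h𝔞 he hstab hx p.1.2 p.2.2 hp
    exact Prod.ext (Subtype.ext h1) (Subtype.ext h2)
  have hsurj : Function.Surjective (infAction 𝔞 (nilLie Ω 𝔞 Z) e) := by
    intro v
    have hv : v ∈ (𝔞 ⊔ nilLie Ω 𝔞 Z).map (evalLin e) := by
      rw [map_evalLin_sup_eq_top hΩ h𝔞 hZ he hfix]; trivial
    obtain ⟨X, hX, rfl⟩ := hv
    obtain ⟨A, hA, N, hN, rfl⟩ := Submodule.mem_sup.1 hX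
    exact ⟨(⟨A, hA⟩, ⟨N, hN⟩), rfl⟩
  -- Bijectivity at e fixes the dimension of 𝔞 × 𝔫, so injectivity at any other point of Ω already
  -- gives surjectivity there.
  have hdim : Module.finrank ℝ (𝔞 × nilLie Ω 𝔞 Z) = Module.finrank ℝ V :=
    (LinearEquiv.ofBijective _ ⟨hinj e he, hsurj⟩).finrank_eq
  exact (LinearMap.injective_iff_surjective_of_finrank_eq_finrank hdim).1 (hinj x hx)

/-- The orbit map `h ↦ h x` of `ℋ`. -/
def orbitMap (Ω : Set V) (𝔞 : Submodule ℝ (V →L[ℝ] V)) (Z : 𝔞) (x : V)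
    (h : iwasawaAN Ω 𝔞 Z) : V :=
  ((h : GLV V) : V →L[ℝ] V) x

omit [FiniteDimensional ℝ V] [CompleteSpace V] in
theorem continuous_orbitMap (x : V) : Continuous (orbitMap Ω 𝔞 Z x) :=
  (continuous_eval_const x).comp (Units.continuous_val.comp continuous_subtype_val)

omit [FiniteDimensional ℝ V] [CompleteSpace V] in
theorem orbitMap_mul (x : V) (g h : iwasawaAN Ω 𝔞 Z) :
    orbitMap Ω 𝔞 Z x (g * h) = orbitMap Ω 𝔞 Z (orbitMap Ω 𝔞 Z x h) g := rfl

variable (hΩ : IsSymmetricCone Ω) (h𝔞 : IsMaximalAbelianInP Ω 𝔞)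
include hΩ h𝔞

theorem iwasawaAN_le_coneAut : iwasawaAN Ω 𝔞 Z ≤ coneAut Ω :=
  (iwasawaAN_le_coneAutZero hΩ h𝔞).trans coneAutZero_le

theorem orbitMap_mem {x : V} (hx : x ∈ Ω) (h : iwasawaAN Ω 𝔞 Z) : orbitMap Ω 𝔞 Z x h ∈ Ω :=
  map_mem_of_mem_coneAut (iwasawaAN_le_coneAut hΩ h𝔞 h.2) hx

variable (hZ : IsRegularElement Ω 𝔞 Z) {e : V} (he : e ∈ Ω)
  (hstab : ∀ g ∈ coneAut Ω, (g : V →L[ℝ] V) e = e → g ∈ orthGroup V)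
  (hfix : ∀ g ∈ coneAut Ω, g ∈ orthGroup V → (g : V →L[ℝ] V) e = e)
include hZ he hstab hfix

/-- Openness at 1, for every base point in Ω, gives openness at h by right translation, which
replaces x by h x. -/
theorem isOpenMap_orbitMap {x : V} (hx : x ∈ Ω) : IsOpenMap (orbitMap Ω 𝔞 Z x) := by
  have key : ∀ x ∈ Ω, 𝓝 x ≤ map (orbitMap Ω 𝔞 Z x) (𝓝 1) := by
    intro x hx
    have h1 : map (fun p : 𝔞 × nilLie Ω 𝔞 Z =>
        (exp (p.1 : V →L[ℝ] V) * exp (p.2 : V →L[ℝ] V)) x) (𝓝 0) = 𝓝 x :=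
      map_exp_mul_exp_nhds_zero (F := V) 𝔞 (nilLie Ω 𝔞 Z) (ContinuousLinearMap.apply ℝ V x)
        (infAction_surjective hΩ h𝔞 hZ he hstab hfix hx)
    let q : 𝔞 × nilLie Ω 𝔞 Z → iwasawaAN Ω 𝔞 Z := fun p =>
      ⟨expUnit (p.1 : V →L[ℝ] V) * expUnit (p.2 : V →L[ℝ] V),
        expUnit_mul_expUnit_mem_iwasawaAN p.1.2 p.2.2⟩
    have hq : Continuous q := by
      refine Continuous.subtype_mk ?_ _
      exact (continuous_expUnit.comp (continuous_subtype_val.comp continuous_fst)).mul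
        (continuous_expUnit.comp (continuous_subtype_val.comp continuous_snd))
    have hq0 : q 0 = 1 := Subtype.ext (by simp [q])
    have h2 : Tendsto q (𝓝 0) (𝓝 1) := by
      have := hq.tendsto 0
      rwa [hq0] at this
    have h3 : (fun p : 𝔞 × nilLie Ω 𝔞 Z => (exp (p.1 : V →L[ℝ] V) * exp (p.2 : V →L[ℝ] V)) x) =
        orbitMap Ω 𝔞 Z x ∘ q := rfl
    rw [h3, ← Filter.map_map] at h1
    exact h1.symm.le.trans (Filter.map_mono h2)
  refine IsOpenMap.of_nhds_le fun h => ?_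
  refine (key _ (orbitMap_mem hΩ h𝔞 hx h)).trans ?_
  have h1 : orbitMap Ω 𝔞 Z (orbitMap Ω 𝔞 Z x h) = orbitMap Ω 𝔞 Z x ∘ fun g => g * h := rfl
  rw [h1, ← Filter.map_map]
  refine Filter.map_mono ?_
  have : Tendsto (fun g : iwasawaAN Ω 𝔞 Z => g * h) (𝓝 1) (𝓝 (1 * h)) :=
    (continuous_mul_const h).tendsto 1
  rwa [one_mul] at this

/-- The orbits are open and partition the connected set Ω. -/
theorem range_orbitMap : Set.range (orbitMap Ω 𝔞 Z e) = Ω := by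
  refine Set.Subset.antisymm (Set.range_subset_iff.2 (orbitMap_mem hΩ h𝔞 he)) ?_
  by_contra hne
  obtain ⟨y, hy, hyA⟩ := Set.not_subset.1 hne
  have hmem : ∀ x : V, x ∈ Set.range (orbitMap Ω 𝔞 Z x) := fun x => ⟨1, rfl⟩
  have hopen : ∀ x ∈ Ω, IsOpen (Set.range (orbitMap Ω 𝔞 Z x)) := fun x hx =>
    (isOpenMap_orbitMap hΩ h𝔞 hZ he hstab hfix hx).isOpen_range
  set A := Set.range (orbitMap Ω 𝔞 Z e) with hA
  obtain ⟨z, -, hzA, hzB⟩ := hΩ.convex.isPreconnected A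
    (⋃ x ∈ Ω \ A, Set.range (orbitMap Ω 𝔞 Z x)) (hopen e he)
    (isOpen_biUnion fun x hx => hopen x hx.1)
    (fun x hx => by
      by_cases h : x ∈ A
      · exact Or.inl h
      · exact Or.inr (Set.mem_biUnion (show x ∈ Ω \ A from ⟨hx, h⟩) (hmem x)))
    ⟨e, he, hmem e⟩ ⟨y, hy, Set.mem_biUnion (show y ∈ Ω \ A from ⟨hy, hyA⟩) (hmem y)⟩
  obtain ⟨x, hx, g, hg⟩ := Set.mem_iUnion₂.1 hzB
  obtain ⟨h, hh⟩ := hzA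
  refine hx.2 ⟨g⁻¹ * h, ?_⟩
  rw [orbitMap_mul, hh, ← hg, ← orbitMap_mul, inv_mul_cancel]
  rfl

theorem isOpenEmbedding_orbitMap : IsOpenEmbedding (orbitMap Ω 𝔞 Z e) := by
  refine .of_continuous_injective_isOpenMap (continuous_orbitMap e) ?_
    (isOpenMap_orbitMap hΩ h𝔞 hZ he hstab hfix he)
  intro g h hgh
  have h1 : orbitMap Ω 𝔞 Z e (h⁻¹ * g) = e := by
    rw [orbitMap_mul, hgh, ← orbitMap_mul, inv_mul_cancel]; rfl
  have h2 := eq_one_of_mem_iwasawaAN_of_apply_eq hΩ h𝔞 hstab (h⁻¹ * g).2 h1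
  have h3 : h⁻¹ * g = 1 := Subtype.ext h2
  exact (inv_mul_eq_one.1 h3).symm

end OrbitMap

/-! ### The invariant measure of the cone -/

section InvariantMeasure

open Filter Topology

variable {V : Type*} [NormedAddCommGroup V] [InnerProductSpace ℝ V] [FiniteDimensional ℝ V]
  [MeasurableSpace V] [BorelSpace V]

/-- The invariant measure of a symmetric cone, with the characteristic function as density. -/
noncomputable def coneMeasure (Ω : Set V) : Measure V := volume.withDensity (coneChar Ω)

variable {Ω : Set V} (hΩ : IsSymmetricCone Ω)
include hΩ

/-- The Jacobian of g cancels the factor in φ(y) = |det g| φ(g y). -/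
theorem coneMeasure_preimage [CompleteSpace V] {g : GLV V} (hg : g ∈ coneAut Ω) {E : Set V}
    (hE : MeasurableSet E) : coneMeasure Ω ((g : V →L[ℝ] V) ⁻¹' E) = coneMeasure Ω E := by
  have hm : MeasurableSet ((g : V →L[ℝ] V) ⁻¹' E) := (g : V →L[ℝ] V).measurable hE
  have h := lintegral_image_eq_lintegral_abs_det_fderiv_mul volume hm
    (f := (g : V →L[ℝ] V)) (f' := fun _ => (g : V →L[ℝ] V))
    (fun x _ => (g : V →L[ℝ] V).hasFDerivWithinAt)
    (fun a _ b _ hab => by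
      rw [← units_inv_apply_apply g a, hab, units_inv_apply_apply]) (coneChar Ω)
  rw [Set.image_preimage_eq _ fun x => ⟨_, units_apply_inv_apply g x⟩] at h
  rw [coneMeasure, withDensity_apply _ hm, withDensity_apply _ hE, h]
  exact lintegral_congr fun x => hΩ.coneChar_eq_mul hg x

theorem coneMeasure_lt_top_of_isCompact {K : Set V} (hK : IsCompact K) (hKΩ : K ⊆ Ω) :
    coneMeasure Ω K < ⊤ := by
  refine hK.measure_lt_top_of_nhdsWithin fun x hx => ?_
  obtain ⟨δ, hδ, hb⟩ := hΩ.exists_closedBall_subset (hKΩ hx)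
  refine ⟨Metric.closedBall x (δ / 2),
    mem_nhdsWithin_of_mem_nhds (Metric.closedBall_mem_nhds x (by positivity)), ?_⟩
  rw [coneMeasure, withDensity_apply _ Metric.isClosed_closedBall.measurableSet]
  have hle : ∀ y ∈ Metric.closedBall x (δ / 2),
      coneChar Ω y ≤ ∫⁻ z : V, ENNReal.ofReal (Real.exp (-(δ / 2 * ‖z‖))) := fun y hy =>
    hΩ.coneChar_le (by positivity) ((Metric.closedBall_subset_closedBall' (by
      rw [Metric.mem_closedBall] at hy; linarith)).trans hb)
  refine (setLIntegral_mono measurable_const hle).trans_lt ?_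
  rw [setLIntegral_const]
  refine ENNReal.mul_lt_top ?_ measure_closedBall_lt_top
  have := (integrable_exp_neg_mul_norm (V := V) (half_pos hδ)).lintegral_lt_top
  exact this

theorem coneMeasure_pos_of_isOpen {U : Set V} (hU : IsOpen U) (hne : U.Nonempty) :
    coneMeasure Ω U ≠ 0 := fun h =>
  (hU.measure_pos volume hne).ne' (withDensity_absolutelyContinuous'
    (measurable_coneChar Ω).aemeasurable (ae_of_all _ hΩ.coneChar_pos) h)

end InvariantMeasure

/-! ### Transfer of the contragredient and of the measure to ℋ -/

section PullBack

open Filter Topology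

variable {V : Type*} [NormedAddCommGroup V] [InnerProductSpace ℝ V] [FiniteDimensional ℝ V]
  [CompleteSpace V] {Ω : Set V} {𝔞 : Submodule ℝ (V →L[ℝ] V)} {Z : 𝔞} {e : V}

omit [FiniteDimensional ℝ V] in
-- g₂⁻¹ g₁ fixes e, hence is orthogonal and unchanged by g ↦ (g*)⁻¹. So that map descends to the
-- orbit of e.
theorem inv_star_apply_eq_of_apply_eq
    (hstab : ∀ g ∈ coneAut Ω, (g : V →L[ℝ] V) e = e → g ∈ orthGroup V) {g₁ g₂ : GLV V}
    (h₁ : g₁ ∈ coneAut Ω) (h₂ : g₂ ∈ coneAut Ω) (h : g₁.val e = g₂.val e) :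
    ((star g₁)⁻¹ : GLV V).val e = ((star g₂)⁻¹ : GLV V).val e := by
  have hs : (g₂⁻¹ * g₁).val e = e := by
    rw [units_mul_apply, h, units_inv_apply_apply]
  have ho := inv_star_of_mem_orthGroup (hstab _ (mul_mem (inv_mem h₂) h₁) hs)
  have h3 : (star g₁)⁻¹ = (star g₂)⁻¹ * (star (g₂⁻¹ * g₁))⁻¹ := by
    rw [← inv_star_mul, mul_inv_cancel_left]
  rw [h3, ho, units_mul_apply, hs]

theorem exists_homeomorph_orbitMap_eq (hΩ : IsSymmetricCone Ω)
    (h𝔞 : IsMaximalAbelianInP Ω 𝔞) (he : e ∈ Ω)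
    (hstab : ∀ g ∈ coneAut Ω, (g : V →L[ℝ] V) e = e → g ∈ orthGroup V)
    (hp : IsOpenEmbedding (orbitMap Ω 𝔞 Z e)) (hrange : Set.range (orbitMap Ω 𝔞 Z e) = Ω) :
    ∃ σ : iwasawaAN Ω 𝔞 Z ≃ₜ iwasawaAN Ω 𝔞 Z, ∀ h : iwasawaAN Ω 𝔞 Z,
      orbitMap Ω 𝔞 Z e (σ h) = ((star (h : GLV V))⁻¹ : GLV V).val e := by
  have hG : ∀ h : iwasawaAN Ω 𝔞 Z, (h : GLV V) ∈ coneAut Ω := fun h =>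
    iwasawaAN_le_coneAut hΩ h𝔞 h.2
  have hθ : ∀ h : iwasawaAN Ω 𝔞 Z, (star (h : GLV V))⁻¹ ∈ coneAut Ω := fun h =>
    inv_mem (hΩ.star_mem (hG h))
  have hex : ∀ h : iwasawaAN Ω 𝔞 Z, ∃ k, orbitMap Ω 𝔞 Z e k =
      ((star (h : GLV V))⁻¹ : GLV V).val e := fun h =>
    hrange.ge (map_mem_of_mem_coneAut (hθ h) he)
  choose σ hσ using hex
  have hinv : Function.Involutive σ := fun h => hp.injective <| by
    rw [hσ, inv_star_apply_eq_of_apply_eq hstab (hG (σ h)) (hθ h) (hσ h), inv_star_inv_star]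
    rfl
  have hcont : Continuous σ := by
    rw [hp.isInducing.continuous_iff]
    have : orbitMap Ω 𝔞 Z e ∘ σ =
        fun h : iwasawaAN Ω 𝔞 Z => ((star (h : GLV V))⁻¹ : GLV V).val e := funext hσ
    rw [this]
    refine (continuous_eval_const e).comp (Units.continuous_val.comp ?_)
    have hs : Continuous (star : GLV V → GLV V) :=
      Units.continuous_iff.2 ⟨continuous_star.comp Units.continuous_val,
        continuous_star.comp Units.continuous_coe_inv⟩
    exact (hs.comp continuous_subtype_val).inv
  exact ⟨⟨hinv.toPerm σ, hcont, hcont⟩, hσ⟩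

variable [MeasurableSpace (iwasawaAN Ω 𝔞 Z)] [BorelSpace (iwasawaAN Ω 𝔞 Z)]

/-- The pulled-back cone measure is invariant under all of 𝒢(Ω). Left translations are a special
case, so it is a Haar measure, and μ, being a multiple of it, inherits the full invariance. -/
theorem map_eq_self_of_orbitMap_eq (hΩ : IsSymmetricCone Ω) (h𝔞 : IsMaximalAbelianInP Ω 𝔞)
    (hp : IsOpenEmbedding (orbitMap Ω 𝔞 Z e)) (hrange : Set.range (orbitMap Ω 𝔞 Z e) = Ω)
    (μ : Measure (iwasawaAN Ω 𝔞 Z)) [μ.IsHaarMeasure] {g : GLV V} (hg : g ∈ coneAut Ω)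
    {a : iwasawaAN Ω 𝔞 Z → iwasawaAN Ω 𝔞 Z}
    (ha : ∀ h, orbitMap Ω 𝔞 Z e (a h) = (g : V →L[ℝ] V) (orbitMap Ω 𝔞 Z e h)) :
    μ.map a = μ := by
  let _ : MeasurableSpace V := borel V
  have _ : BorelSpace V := ⟨rfl⟩
  have _ : LocallyCompactSpace (iwasawaAN Ω 𝔞 Z) := hp.locallyCompactSpace
  have _ : SecondCountableTopology (iwasawaAN Ω 𝔞 Z) := hp.isEmbedding.secondCountableTopology
  set ν : Measure (iwasawaAN Ω 𝔞 Z) := (coneMeasure Ω).comap (orbitMap Ω 𝔞 Z e)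
  have hν : ∀ S, ν S = coneMeasure Ω (orbitMap Ω 𝔞 Z e '' S) := fun S =>
    hp.measurableEmbedding.comap_apply _ S
  have hinv : ∀ {g : GLV V} (_ : g ∈ coneAut Ω) {a : iwasawaAN Ω 𝔞 Z → iwasawaAN Ω 𝔞 Z}
      (_ : ∀ h, orbitMap Ω 𝔞 Z e (a h) = (g : V →L[ℝ] V) (orbitMap Ω 𝔞 Z e h)),
      Measurable a ∧ ν.map a = ν := by
    intro g hg a ha
    have hcont : Continuous a := by
      rw [hp.isInducing.continuous_iff]
      have : orbitMap Ω 𝔞 Z e ∘ a = fun h => (g : V →L[ℝ] V) (orbitMap Ω 𝔞 Z e h) := funext ha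
      rw [this]
      exact (g : V →L[ℝ] V).continuous.comp hp.continuous
    refine ⟨hcont.measurable, Measure.ext fun S hS => ?_⟩
    rw [Measure.map_apply hcont.measurable hS, hν, hν,
      ← coneMeasure_preimage hΩ hg (hp.measurableEmbedding.measurableSet_image.2 hS)]
    congr 1
    ext x
    constructor
    · rintro ⟨h, hh, rfl⟩
      exact ⟨a h, hh, ha h⟩
    · rintro ⟨k, hk, hkx⟩
      have hx : x ∈ Set.range (orbitMap Ω 𝔞 Z e) := by
        have h1 : (g : V →L[ℝ] V) x ∈ Ω := hkx ▸ hrange.le ⟨k, rfl⟩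
        have h2 := map_mem_of_mem_coneAut (inv_mem hg) h1
        rw [units_inv_apply_apply] at h2
        exact hrange.ge h2
      obtain ⟨h, rfl⟩ := hx
      refine ⟨h, ?_, rfl⟩
      have : a h = k := hp.injective (by rw [ha, hkx])
      rwa [Set.mem_preimage, this]
  have _ : ν.IsMulLeftInvariant := ⟨fun h₀ =>
    (hinv (iwasawaAN_le_coneAut hΩ h𝔞 h₀.2) (a := fun h => h₀ * h) fun _ => rfl).2⟩
  have _ : IsFiniteMeasureOnCompacts ν := ⟨fun K hK => by
    rw [hν]
    refine coneMeasure_lt_top_of_isCompact hΩ (hK.image hp.continuous) ?_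
    exact (Set.image_subset_range _ _).trans hrange.le⟩
  have _ : ν.IsOpenPosMeasure := ⟨fun U hU hne => by
    rw [hν]
    exact coneMeasure_pos_of_isOpen hΩ (hp.isOpenMap U hU) (hne.image _)⟩
  have _ : ν.IsHaarMeasure := {}
  rw [Measure.isMulLeftInvariant_eq_smul μ ν, Measure.map_smul, (hinv hg ha).2]

end PullBack

/-! ### The integral formula -/

theorem mainTheorem8 {V : Type*} [NormedAddCommGroup V] [InnerProductSpace ℝ V]
    [FiniteDimensional ℝ V] [CompleteSpace V]
    (Ω : Set V) (hΩ : IsSymmetricCone Ω)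
    (𝔞 : Submodule ℝ (V →L[ℝ] V)) (h𝔞 : IsMaximalAbelianInP Ω 𝔞)
    (Z : 𝔞) (hZ : IsRegularElement Ω 𝔞 Z)
    [MeasurableSpace (iwasawaAN Ω 𝔞 Z)] [BorelSpace (iwasawaAN Ω 𝔞 Z)]
    (μ : Measure (iwasawaAN Ω 𝔞 Z)) [μ.IsHaarMeasure] :
    ∃ C : ℝ, 0 < C ∧ ∀ F : GLV V → ℂ,
      (∀ g ∈ coneAutZero Ω, ∀ k ∈ coneK Ω, F (g * k) = F g) →
      Integrable (fun h : iwasawaAN Ω 𝔞 Z => F (h : GLV V)) μ →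
        Integrable (fun h : iwasawaAN Ω 𝔞 Z => F ((star (h : GLV V))⁻¹)) μ ∧
        ∫ h : iwasawaAN Ω 𝔞 Z, F (h : GLV V) ∂μ =
          (C : ℂ) * ∫ h : iwasawaAN Ω 𝔞 Z, F ((star (h : GLV V))⁻¹) ∂μ := by
  obtain ⟨e, he, hstab, hfix⟩ := hΩ.exists_mem_stabilizer_le_orthGroup
  have hp := isOpenEmbedding_orbitMap hΩ h𝔞 hZ he hstab hfix
  have hrange := range_orbitMap hΩ h𝔞 hZ he hstab hfix
  obtain ⟨σ, hσ⟩ := exists_homeomorph_orbitMap_eq hΩ h𝔞 he hstab hp hrange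
  have _ : LocallyCompactSpace (iwasawaAN Ω 𝔞 Z) := hp.locallyCompactSpace
  have _ : SecondCountableTopology (iwasawaAN Ω 𝔞 Z) := hp.isEmbedding.secondCountableTopology
  have hG : ∀ h : iwasawaAN Ω 𝔞 Z, (h : GLV V) ∈ coneAut Ω := fun h =>
    iwasawaAN_le_coneAut hΩ h𝔞 h.2
  have hθ : ∀ h : iwasawaAN Ω 𝔞 Z, (star (h : GLV V))⁻¹ ∈ coneAut Ω := fun h =>
    inv_mem (hΩ.star_mem (hG h))
  have _ : (μ.map σ).IsMulLeftInvariant := ⟨fun h₀ => by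
    have hex : ∀ h : iwasawaAN Ω 𝔞 Z, ∃ k : iwasawaAN Ω 𝔞 Z, orbitMap Ω 𝔞 Z e k =
        ((star (h₀ : GLV V))⁻¹ : GLV V).val (orbitMap Ω 𝔞 Z e h) := fun h =>
      hrange.ge (map_mem_of_mem_coneAut (hθ h₀) (orbitMap_mem hΩ h𝔞 he h))
    choose a ha using hex
    have hacont : Continuous a := by
      rw [hp.isInducing.continuous_iff, show orbitMap Ω 𝔞 Z e ∘ a = _ from funext ha]
      exact (((star (h₀ : GLV V))⁻¹ : GLV V) : V →L[ℝ] V).continuous.comp hp.continuous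
    -- σ carries the transported action of (h₀*)⁻¹ to left translation by h₀; since `a` preserves μ,
    -- the image of μ under σ is left invariant.
    have hcomm : (fun h => h₀ * h) ∘ σ = σ ∘ a := funext fun h => hp.injective <| by
      have h1 : (a h : GLV V).val e = ((star (h₀ : GLV V))⁻¹ * (h : GLV V)).val e := ha h
      rw [Function.comp_apply, Function.comp_apply, orbitMap_mul, hσ, hσ,
        inv_star_apply_eq_of_apply_eq hstab (hG (a h)) (mul_mem (hθ h₀) (hG h)) h1, inv_star_mul,
        inv_star_inv_star]
      rfl
    rw [Measure.map_map (measurable_const_mul h₀) σ.continuous.measurable, hcomm,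
      ← Measure.map_map σ.continuous.measurable hacont.measurable,
      map_eq_self_of_orbitMap_eq hΩ h𝔞 hp hrange μ (hθ h₀) ha]⟩
  have _ : IsFiniteMeasureOnCompacts (μ.map σ) := Measure.IsFiniteMeasureOnCompacts.map μ σ
  have _ : (μ.map σ).IsOpenPosMeasure :=
    σ.continuous.isOpenPosMeasure_map σ.surjective
  have _ : (μ.map σ).IsHaarMeasure := {}
  set c : NNReal := Measure.haarScalarFactor (μ.map σ) μ
  have hc : 0 < c := Measure.haarScalarFactor_pos_of_isHaarMeasure _ _
  have hmap : μ.map σ = c • μ := Measure.isMulLeftInvariant_eq_smul _ _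
  refine ⟨(c : ℝ)⁻¹, by positivity, fun F hF hint => ?_⟩
  have hFσ : (fun h : iwasawaAN Ω 𝔞 Z => F ((star (h : GLV V))⁻¹)) =
      (fun h : iwasawaAN Ω 𝔞 Z => F h) ∘ σ := by
    ext1 h
    have h0 : (σ h : GLV V) ∈ coneAutZero Ω := iwasawaAN_le_coneAutZero hΩ h𝔞 (σ h).2
    -- Both elements lie in 𝒢₀(Ω) and agree at e, so their quotient is in the stabiliser of e, which
    -- is orthogonal.
    have hk : (σ h : GLV V)⁻¹ * (star (h : GLV V))⁻¹ ∈ coneK Ω := by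
      refine ⟨(coneAutZero Ω).mul_mem ((coneAutZero Ω).inv_mem h0)
        (inv_star_mem_coneAutZero hΩ h𝔞 h.2), hstab _
        (mul_mem (inv_mem (hG _)) (hθ h)) ?_⟩
      rw [units_mul_apply, ← hσ]
      exact units_inv_apply_apply _ _
    have := hF _ h0 _ hk
    rwa [mul_inv_cancel_left] at this
  have hemb : MeasurableEmbedding σ := σ.isClosedEmbedding.measurableEmbedding
  rw [hFσ]
  refine ⟨(hemb.integrable_map_iff).1 ?_, ?_⟩
  · rw [hmap]
    exact hint.smul_measure_nnreal
  · have h1 : ∫ h, ((fun h : iwasawaAN Ω 𝔞 Z => F h) ∘ σ) h ∂μ =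
        (c : ℝ) • ∫ h : iwasawaAN Ω 𝔞 Z, F h ∂μ := by
      rw [← NNReal.smul_def, ← integral_smul_nnreal_measure, ← hmap, hemb.integral_map]
      rfl
    rw [h1, Complex.real_smul, ← mul_assoc, ← Complex.ofReal_mul, inv_mul_cancel₀ (by positivity),
      Complex.ofReal_one, one_mul]
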